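/- Consider the elliptic Euler–Darboux equation $$\mathcal E_{ED}:\quad F:=(x+y)(u_{xx}+u_{yy})+u_x+u_y=0$$ on the trivial bundle $\mathbb R^2\times\mathbb R\to\mathbb R^2$, with jet coordinates $x,y,u_{hx,ky}$ ($h,k\ge 0$). Let $D_x,D_y$ be the total derivatives and let $\mathcal E_{ED}^\infty=\{D_x^hD_y^kF=0 \text{ for all } h,k\ge 0\}$ be the infinite prolongation, taken over the domain $x+y\neq 0$; on it $x,\ y,\ u_{ky}:=u_{0x,ky}$ and $u_{x,ky}:=u_{1x,ky}$ ($k\ge 0$) are internal coordinates. Let $\varphi$ be a real rational function of finitely many jet coordinates which restricts to $\mathcal E_{ED}^\infty$ (its denominator can be chosen not identically zero there) and which is (the generating section of) a higher symmetry of $\mathcal E_{ED}$: the evolutionary field $$X_\varphi=\sum_{h,k\ge 0}D_x^hD_y^k(\varphi)\,\frac{\partial}{\partial u_{hx,ky}}$$ satisfies $X_\varphi(F)|_{\mathcal E_{ED}^\infty}=0$. Then $\varphi$ is linear in the internal jet variables, up to an additive solution of the equation: there are $N\ge 0$, rational functions $a_k,b_k\in\mathbb R(x,y)$ and a rational solution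 $f\in\mathbb R(x,y)$ of $\mathcal E_{ED}$ such that $$\varphi|_{\mathcal E_{ED}^\infty}=f(x,y)+\sum_{0\le k<N}a_k(x,y)\,u_{x,ky}+\sum_{0\le k<N}b_k(x,y)\,u_{ky}.$$ -/

import Mathlib

noncomputable section

namespace EulerDarboux

/-- Standard coordinates on the infinite jet space of the trivial bundle `ℝ² × ℝ → ℝ²`:
the base coordinates `x`, `y`, and `u h k`, the derivative of the dependent variable taken
`h` times in `x` and `k` times in `y` (so `u 0 0` is the dependent variable itself). -/
inductive JetVar : Type
  | x : JetVar
  | y : JetVar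
  | u : ℕ → ℕ → JetVar

/-- Polynomial functions on the infinite jet space (each involves finitely many coordinates). -/
abbrev JetPoly : Type := MvPolynomial JetVar ℝ

/-- Real rational functions on the infinite jet space. -/
abbrev JetRat : Type := FractionRing JetPoly

/-- Points of the infinite jet space, given by their coordinates. -/
abbrev JetPoint : Type := JetVar → ℝ

/-- A jet coordinate as a rational function. -/
def coord (v : JetVar) : JetRat := algebraMap JetPoly JetRat (MvPolynomial.X v)

/-! ### Vector fields on rational functions -/

section Quotient

variable {R A K : Type*} [CommRing R] [CommRing A] [IsDomain A] [Field K] [Algebra R A]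
  [Algebra R K] [Algebra A K] [IsScalarTower R A K] [IsFractionRing A K]

/-- The quotient rule, as a function of numerator and denominator. -/
def quotRule (d : Derivation R A K) (p q : A) : K :=
  (algebraMap A K q * d p - algebraMap A K p * d q) / (algebraMap A K q) ^ 2

theorem algebraMap_ne {q : A} (hq : q ≠ 0) : algebraMap A K q ≠ 0 := by
  intro h
  exact hq (IsFractionRing.injective A K (by rw [h, map_zero]))

theorem quotRule_congr (d : Derivation R A K) {p q p' q' : A}
    (hq : q ≠ 0) (hq' : q' ≠ 0)
    (h : algebraMap A K p / algebraMap A K q = algebraMap A K p' / algebraMap A K q') :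
    quotRule d p q = quotRule d p' q' := by
  have hQ : algebraMap A K q ≠ 0 := algebraMap_ne hq
  have hQ' : algebraMap A K q' ≠ 0 := algebraMap_ne hq'
  rw [div_eq_div_iff hQ hQ'] at h
  have hpoly : p * q' = p' * q := by
    apply IsFractionRing.injective A K
    simpa using h
  have hd := congrArg d hpoly
  simp only [Derivation.leibniz, Algebra.smul_def] at hd
  unfold quotRule
  rw [div_eq_div_iff (pow_ne_zero 2 hQ) (pow_ne_zero 2 hQ')]
  linear_combination (algebraMap A K q * algebraMap A K q') * hd -
    (algebraMap A K q' * d q + algebraMap A K q * d q') * h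

/-- Extension of a derivation to the fraction field by the quotient rule. -/
def extendFun (d : Derivation R A K) (r : K) : K :=
  quotRule d (IsLocalization.sec (nonZeroDivisors A) r).1
    (IsLocalization.sec (nonZeroDivisors A) r).2

theorem extendFun_div (d : Derivation R A K) (p : A) {q : A} (hq : q ≠ 0) :
    extendFun d (algebraMap A K p / algebraMap A K q) = quotRule d p q := by
  apply quotRule_congr d (nonZeroDivisors.ne_zero (SetLike.coe_mem _)) hq
  rw [← IsFractionRing.mk'_eq_div, IsLocalization.mk'_sec]

theorem extendFun_add (d : Derivation R A K) (r s : K) :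
    extendFun d (r + s) = extendFun d r + extendFun d s := by
  obtain ⟨p, q, hq, rfl⟩ := IsFractionRing.div_surjective (A := A) r
  obtain ⟨p', q', hq', rfl⟩ := IsFractionRing.div_surjective (A := A) s
  have hq := nonZeroDivisors.ne_zero hq
  have hq' := nonZeroDivisors.ne_zero hq'
  have hQ : algebraMap A K q ≠ 0 := algebraMap_ne hq
  have hQ' : algebraMap A K q' ≠ 0 := algebraMap_ne hq'
  have e : algebraMap A K p / algebraMap A K q + algebraMap A K p' / algebraMap A K q' =
      algebraMap A K (p * q' + q * p') / algebraMap A K (q * q') := by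
    simp only [map_add, map_mul]
    field_simp
  rw [e, extendFun_div d _ (mul_ne_zero hq hq'), extendFun_div d _ hq, extendFun_div d _ hq']
  simp only [quotRule, map_add, map_mul, Derivation.leibniz, Algebra.smul_def]
  field_simp
  ring

theorem extendFun_mul (d : Derivation R A K) (r s : K) :
    extendFun d (r * s) = r * extendFun d s + s * extendFun d r := by
  obtain ⟨p, q, hq, rfl⟩ := IsFractionRing.div_surjective (A := A) r
  obtain ⟨p', q', hq', rfl⟩ := IsFractionRing.div_surjective (A := A) s
  have hq := nonZeroDivisors.ne_zero hq
  have hq' := nonZeroDivisors.ne_zero hq'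
  have hQ : algebraMap A K q ≠ 0 := algebraMap_ne hq
  have hQ' : algebraMap A K q' ≠ 0 := algebraMap_ne hq'
  have e : algebraMap A K p / algebraMap A K q * (algebraMap A K p' / algebraMap A K q') =
      algebraMap A K (p * p') / algebraMap A K (q * q') := by
    simp only [map_mul]
    field_simp
  rw [e, extendFun_div d _ (mul_ne_zero hq hq'), extendFun_div d _ hq, extendFun_div d _ hq']
  simp only [quotRule, map_mul, Derivation.leibniz, Algebra.smul_def]
  field_simp
  ring

theorem extendFun_algebraMap (d : Derivation R A K) (p : A) :
    extendFun d (algebraMap A K p) = d p := by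
  have h := extendFun_div d p (one_ne_zero (α := A))
  rw [map_one, div_one] at h
  rw [h]
  simp [quotRule]

theorem extendFun_smul (d : Derivation R A K) (c : R) (r : K) :
    extendFun d (c • r) = c • extendFun d r := by
  rw [Algebra.smul_def, Algebra.smul_def, extendFun_mul, IsScalarTower.algebraMap_apply R A K,
    extendFun_algebraMap, Derivation.map_algebraMap, mul_zero, add_zero]

/-- The extension is a derivation. -/
def extend (d : Derivation R A K) : Derivation R K K :=
  Derivation.mk'
    { toFun := extendFun d
      map_add' := extendFun_add d
      map_smul' := extendFun_smul d }
    (extendFun_mul d)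

theorem extend_algebraMap (d : Derivation R A K) (p : A) : extend d (algebraMap A K p) = d p :=
  extendFun_algebraMap d p

end Quotient

/-- The vector field `∑ v, c v • ∂/∂v` on the infinite jet space, acting on rational
functions. -/
def vectorField (c : JetVar → JetRat) : Derivation ℝ JetRat JetRat :=
  extend (MvPolynomial.mkDerivation ℝ c)

theorem vectorField_algebraMap (c : JetVar → JetRat) (p : JetPoly) :
    vectorField c (algebraMap JetPoly JetRat p) = MvPolynomial.mkDerivation ℝ c p :=
  extend_algebraMap _ p

theorem vectorField_coord (c : JetVar → JetRat) (v : JetVar) :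
    vectorField c (coord v) = c v := by
  rw [coord, vectorField_algebraMap, MvPolynomial.mkDerivation_X]

/-- The partial derivative with respect to the base coordinate `x`. -/
def partialX : Derivation ℝ JetRat JetRat :=
  vectorField fun v => match v with
    | .x => 1
    | .y => 0
    | .u _ _ => 0

/-- The partial derivative with respect to the base coordinate `y`. -/
def partialY : Derivation ℝ JetRat JetRat :=
  vectorField fun v => match v with
    | .x => 0
    | .y => 1
    | .u _ _ => 0

/-- The total derivative `D_x = ∂/∂x + ∑ u_{(h+1)x,ky} ∂/∂u_{hx,ky}` on rational functions. -/
def totalX : Derivation ℝ JetRat JetRat :=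
  vectorField fun v => match v with
    | .x => 1
    | .y => 0
    | .u h k => coord (.u (h + 1) k)

/-- The total derivative `D_y = ∂/∂y + ∑ u_{hx,(k+1)y} ∂/∂u_{hx,ky}` on rational functions. -/
def totalY : Derivation ℝ JetRat JetRat :=
  vectorField fun v => match v with
    | .x => 0
    | .y => 1
    | .u h k => coord (.u h (k + 1))

/-- The evolutionary vector field `X_φ = ∑ D_x^h D_y^k (φ) ∂/∂u_{hx,ky}` with generating
section `φ`. -/
def evolutionary (φ : JetRat) : Derivation ℝ JetRat JetRat :=
  vectorField fun v => match v with
    | .x => 0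
    | .y => 0
    | .u h k => totalX^[h] (totalY^[k] φ)

/-! ### The equation and its infinite prolongation -/

/-- The total derivative `D_x` on polynomial functions. -/
def polyTotalX : Derivation ℝ JetPoly JetPoly :=
  MvPolynomial.mkDerivation ℝ fun v => match v with
    | .x => 1
    | .y => 0
    | .u h k => MvPolynomial.X (.u (h + 1) k)

/-- The total derivative `D_y` on polynomial functions. -/
def polyTotalY : Derivation ℝ JetPoly JetPoly :=
  MvPolynomial.mkDerivation ℝ fun v => match v with
    | .x => 0
    | .y => 1
    | .u h k => MvPolynomial.X (.u h (k + 1))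

/-- The left-hand side `F = (x + y) (u_xx + u_yy) + u_x + u_y` of the elliptic
Euler–Darboux equation. -/
def F : JetPoly :=
  (MvPolynomial.X .x + MvPolynomial.X .y) *
      (MvPolynomial.X (.u 2 0) + MvPolynomial.X (.u 0 2)) +
    MvPolynomial.X (.u 1 0) + MvPolynomial.X (.u 0 1)

/-- The infinite prolongation of the equation `F = 0`, over the domain `x + y ≠ 0` where the
equation is of second order: all points at which `F` and all its total derivatives vanish. -/
def prolongation : Set JetPoint :=
  {θ | θ .x + θ .y ≠ 0 ∧
    ∀ h k : ℕ, MvPolynomial.eval θ (polyTotalX^[h] (polyTotalY^[k] F)) = 0}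

/-- A rational function `r` restricts to a rational function on the prolongation: it can be
written with a denominator that is not identically zero there. -/
def Restricts (r : JetRat) : Prop :=
  ∃ p q : JetPoly, (∃ θ ∈ prolongation, MvPolynomial.eval θ q ≠ 0) ∧
    r = algebraMap JetPoly JetRat p / algebraMap JetPoly JetRat q

/-- The restriction of the rational function `r` to the prolongation is defined and is zero. -/
def VanishesOnProlongation (r : JetRat) : Prop :=
  ∃ p q : JetPoly, (∃ θ ∈ prolongation, MvPolynomial.eval θ q ≠ 0) ∧
    (∀ θ ∈ prolongation, MvPolynomial.eval θ p = 0) ∧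
    r = algebraMap JetPoly JetRat p / algebraMap JetPoly JetRat q

/-- `φ` is (the generating section of) a rational higher symmetry of the elliptic
Euler–Darboux equation: `X_φ(F)` vanishes on the infinite prolongation. -/
def IsRationalSymmetry (φ : JetRat) : Prop :=
  Restricts φ ∧ VanishesOnProlongation (evolutionary φ (algebraMap JetPoly JetRat F))

/-- The subfield `ℝ(x, y)` of rational functions of the base coordinates. -/
def baseField : IntermediateField ℝ JetRat :=
  IntermediateField.adjoin ℝ {coord .x, coord .y}

/-- A rational function `f` of the base coordinates solves the elliptic Euler–Darboux
equation. -/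
def IsRationalSolution (f : JetRat) : Prop :=
  f ∈ baseField ∧
    (coord .x + coord .y) * (partialX (partialX f) + partialY (partialY f)) +
      partialX f + partialY f = 0

end EulerDarboux

end

noncomputable section

namespace EulerDarboux

/-! ### The restriction of polynomial functions to the prolongation -/

/-! On the prolongation every jet coordinate is a function of `x`, `y`, `u_{ky}`, `u_{x,ky}`, so the
restriction `g` of a symmetry is a rational function of these. Since `F` is linear, `g` satisfies
the same equation with the internal total derivatives `intX`, `intY` in place of `D_x`, `D_y`. After
complexification the equation is hyperbolic in characteristic coordinates. Linear forms `T k`, `k :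
ℤ`, with `T 0 = u` form a ladder: `D_ζ` shifts the index up and `D_ζ̄` shifts it down, with odd
integer coefficients, which never vanish. The derivations `adapted k`, playing the role of `∂/∂(T
k)`, commute with the total derivatives up to the corresponding shifts (`adapted_cX`, `adapted_cY`).
Only finitely many `∂g/∂(T k)` are nonzero. Descending from the largest index, the equation puts
`∂g/∂(T k)` under a first-order operator along `D_ζ̄`, up to terms already known to be annihilated
by all `adapted l`. As there are no nontrivial integrals along the characteristics
(`isBasic_of_cZbar`), each `∂g/∂(T k)` is itself annihilated by all `adapted l` (`isBasic_adapted`).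
Comparing the extreme rungs `±n` of the ladder with the jet variables of top order shows that such
functions do not depend on the jet variables (`IsBasic.cPartial_eq_zero`). So all second jet
derivatives of `g` vanish and `g` is affine. The scaling field commutes with the total derivatives
and extracts the linear part, which therefore solves the equation; so does the remainder `f`. -/

/-- Polynomials in the jet coordinates (`some v`) and the inverse of `x + y` (`none`). -/
abbrev LocPoly : Type := MvPolynomial (Option JetVar) ℝ

/-- The locally defined coordinate function `v`. -/
def loc (v : JetVar) : LocPoly := MvPolynomial.X (some v)

/-- The inverse of `x + y` among the locally defined functions. -/
def locInv : LocPoly := MvPolynomial.X none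

/-- The derivative `D_y` in internal coordinates. -/
def locY : Derivation ℝ LocPoly LocPoly :=
  MvPolynomial.mkDerivation ℝ fun v => match v with
    | none => -locInv ^ 2
    | some .x => 0
    | some .y => 1
    | some (.u 0 k) => loc (.u 0 (k + 1))
    | some (.u 1 k) => loc (.u 1 (k + 1))
    | some (.u (_ + 2) _) => 0

/-- The internal expression of `u_xx`. -/
def locXX : LocPoly := -loc (.u 0 2) - locInv * (loc (.u 1 0) + loc (.u 0 1))

/-- The derivative `D_x` in internal coordinates. -/
def locX : Derivation ℝ LocPoly LocPoly :=
  MvPolynomial.mkDerivation ℝ fun v => match v with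
    | none => -locInv ^ 2
    | some .x => 1
    | some .y => 0
    | some (.u 0 k) => loc (.u 1 k)
    | some (.u 1 k) => locY^[k] locXX
    | some (.u (_ + 2) _) => 0

section
open MvPolynomial
@[simp] theorem locY_inv : locY locInv = -locInv ^ 2 := mkDerivation_X _ _ _
@[simp] theorem locY_x : locY (loc .x) = 0 := mkDerivation_X _ _ _
@[simp] theorem locY_y : locY (loc .y) = 1 := mkDerivation_X _ _ _
@[simp] theorem locY_v (k : ℕ) : locY (loc (.u 0 k)) = loc (.u 0 (k + 1)) := mkDerivation_X _ _ _
@[simp] theorem locY_w (k : ℕ) : locY (loc (.u 1 k)) = loc (.u 1 (k + 1)) := mkDerivation_X _ _ _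
@[simp] theorem locY_high (h k : ℕ) : locY (loc (.u (h + 2) k)) = 0 := mkDerivation_X _ _ _
@[simp] theorem locX_inv : locX locInv = -locInv ^ 2 := mkDerivation_X _ _ _
@[simp] theorem locX_x : locX (loc .x) = 1 := mkDerivation_X _ _ _
@[simp] theorem locX_y : locX (loc .y) = 0 := mkDerivation_X _ _ _
@[simp] theorem locX_v (k : ℕ) : locX (loc (.u 0 k)) = loc (.u 1 k) := mkDerivation_X _ _ _
@[simp] theorem locX_w (k : ℕ) : locX (loc (.u 1 k)) = locY^[k] locXX := mkDerivation_X _ _ _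
@[simp] theorem locX_high (h k : ℕ) : locX (loc (.u (h + 2) k)) = 0 := mkDerivation_X _ _ _

theorem loc_derivation_ext {D₁ D₂ : Derivation ℝ LocPoly LocPoly}
    (h₀ : D₁ locInv = D₂ locInv) (h : ∀ v, D₁ (loc v) = D₂ (loc v)) : D₁ = D₂ :=
  derivation_ext fun i => match i with
    | none => h₀
    | some v => h v

/-- No compatibility condition arises: `locX` is defined on `u_{x,ky}` as the `k`-th
`locY`-derivative of `locXX`, so commutation on the generators is built in. -/
theorem locX_locY (g : LocPoly) : locX (locY g) = locY (locX g) := by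
  have : ⁅locX, locY⁆ = 0 := by
    apply loc_derivation_ext
    · simp [Derivation.commutator_apply, Derivation.leibniz_pow]
    · rintro (_ | _ | ⟨_ | _ | h, k⟩) <;>
        simp [Derivation.commutator_apply, -Function.iterate_succ, Function.iterate_succ_apply']
  simpa [Derivation.commutator_apply, sub_eq_zero] using congrArg (· g) this

theorem locX_iterate_locY (h : ℕ) (g : LocPoly) : locX^[h] (locY g) = locY (locX^[h] g) :=
  (Function.Commute.iterate_left (f := locX) (g := locY) locX_locY h) g

/-- The restriction of polynomial functions to the prolongation, in internal coordinates. -/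
def toLoc : JetPoly →ₐ[ℝ] LocPoly :=
  aeval fun v => match v with
    | .x => loc .x
    | .y => loc .y
    | .u h k => locX^[h] (loc (.u 0 k))

@[simp] theorem toLoc_x : toLoc (X .x) = loc .x := aeval_X _ _
@[simp] theorem toLoc_y : toLoc (X .y) = loc .y := aeval_X _ _
@[simp] theorem toLoc_u (h k : ℕ) : toLoc (X (.u h k)) = locX^[h] (loc (.u 0 k)) := aeval_X _ _

theorem polyTotalX_x : polyTotalX (X .x) = 1 := mkDerivation_X _ _ _
theorem polyTotalX_y : polyTotalX (X .y) = 0 := mkDerivation_X _ _ _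
theorem polyTotalX_u (h k : ℕ) : polyTotalX (X (.u h k)) = X (.u (h + 1) k) := mkDerivation_X _ _ _
theorem polyTotalY_x : polyTotalY (X .x) = 0 := mkDerivation_X _ _ _
theorem polyTotalY_y : polyTotalY (X .y) = 1 := mkDerivation_X _ _ _
theorem polyTotalY_u (h k : ℕ) : polyTotalY (X (.u h k)) = X (.u h (k + 1)) := mkDerivation_X _ _ _

/-- A ring homomorphism that intertwines derivations on the coordinates does so everywhere. -/
theorem intertwine {σ A : Type*} [CommRing A] [Algebra ℝ A] (f : MvPolynomial σ ℝ →ₐ[ℝ] A)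
    (D : Derivation ℝ (MvPolynomial σ ℝ) (MvPolynomial σ ℝ)) (D' : Derivation ℝ A A)
    (h : ∀ i, f (D (X i)) = D' (f (X i))) (p : MvPolynomial σ ℝ) : f (D p) = D' (f p) := by
  induction p using MvPolynomial.induction_on with
  | C a => rw [← algebraMap_eq]; simp
  | add p q hp hq => simp only [map_add, hp, hq]
  | mul_X p i hp => simp only [map_mul, Derivation.leibniz, map_add, smul_eq_mul, hp, h]

theorem toLoc_polyTotalX (p : JetPoly) : toLoc (polyTotalX p) = locX (toLoc p) := by
  apply intertwine
  rintro (_ | _ | ⟨h, k⟩)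
  · simp [polyTotalX_x]
  · simp [polyTotalX_y]
  · rw [polyTotalX_u, toLoc_u, toLoc_u, Function.iterate_succ_apply']

theorem toLoc_polyTotalY (p : JetPoly) : toLoc (polyTotalY p) = locY (toLoc p) := by
  apply intertwine
  rintro (_ | _ | ⟨h, k⟩)
  · simp [polyTotalY_x]
  · simp [polyTotalY_y]
  · rw [polyTotalY_u, toLoc_u, toLoc_u, ← locY_v, locX_iterate_locY]

theorem toLoc_totalX_iterate (h : ℕ) (p : JetPoly) :
    toLoc (polyTotalX^[h] p) = locX^[h] (toLoc p) :=
  Function.Semiconj.iterate_right (f := toLoc) (ga := polyTotalX) (gb := locX) toLoc_polyTotalX h p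

theorem toLoc_totalY_iterate (h : ℕ) (p : JetPoly) :
    toLoc (polyTotalY^[h] p) = locY^[h] (toLoc p) :=
  Function.Semiconj.iterate_right (f := toLoc) (ga := polyTotalY) (gb := locY) toLoc_polyTotalY h p

/-- `locInv` is an independent variable here, so `F` does not map to zero, only into the ideal of
the relation `(x + y) locInv = 1`. -/
theorem toLoc_F :
    toLoc F = (1 - (loc .x + loc .y) * locInv) * (loc (.u 1 0) + loc (.u 0 1)) := by
  simp only [F, map_add, map_mul, toLoc_x, toLoc_y, toLoc_u, Function.iterate_succ_apply,
    Function.iterate_zero_apply, locX_v, locX_w, locXX]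
  ring

/-- The multiples of `1 - (x + y) locInv`, as a predicate. -/
def Spurious (g : LocPoly) : Prop := (1 - (loc .x + loc .y) * locInv) ∣ g

/-- The ideal is differential because `D (1 - (x + y) I) = -I (1 - (x + y) I)` when `D I = -I ^ 2`
and `D (x + y) = 1`. -/
theorem Spurious.locX {g : LocPoly} (hg : Spurious g) : Spurious (locX g) := by
  obtain ⟨c, rfl⟩ := hg
  refine ⟨EulerDarboux.locX c - locInv * c, ?_⟩
  simp only [Derivation.leibniz, map_sub, map_add, smul_eq_mul, locX_inv, locX_x, locX_y,
    Derivation.map_one_eq_zero]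
  ring

theorem Spurious.locY {g : LocPoly} (hg : Spurious g) : Spurious (locY g) := by
  obtain ⟨c, rfl⟩ := hg
  refine ⟨EulerDarboux.locY c - locInv * c, ?_⟩
  simp only [Derivation.leibniz, map_sub, map_add, smul_eq_mul, locY_inv, locY_x, locY_y,
    Derivation.map_one_eq_zero]
  ring

theorem spurious_F (h k : ℕ) : Spurious (toLoc (polyTotalX^[h] (polyTotalY^[k] F))) := by
  rw [toLoc_totalX_iterate, toLoc_totalY_iterate]
  induction h with
  | zero =>
    induction k with
    | zero => exact ⟨_, toLoc_F⟩
    | succ k ih => simpa only [Function.iterate_zero_apply, Function.iterate_succ_apply'] using ih.locY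
  | succ h ih => rw [Function.iterate_succ_apply']; exact ih.locX

/-! ### Points of the prolongation versus values of the internal coordinates -/

/-- Evaluation of locally defined functions at a point. -/
def locEval (t : JetPoint) : LocPoly →ₐ[ℝ] ℝ :=
  aeval fun v => match v with
    | none => (t .x + t .y)⁻¹
    | some v => t v

@[simp] theorem locEval_inv (t : JetPoint) : locEval t locInv = (t .x + t .y)⁻¹ := aeval_X _ _
@[simp] theorem locEval_loc (t : JetPoint) (v : JetVar) : locEval t (loc v) = t v := aeval_X _ _

theorem Spurious.locEval {g : LocPoly} (hg : Spurious g) {t : JetPoint} (ht : t .x + t .y ≠ 0) :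
    locEval t g = 0 := by
  obtain ⟨c, rfl⟩ := hg
  simp [ht]

theorem eval_eq_locEval_of_coord {t θ : JetPoint}
    (h : ∀ v, θ v = EulerDarboux.locEval t (toLoc (X v))) (p : JetPoly) :
    eval θ p = EulerDarboux.locEval t (toLoc p) := by
  have : (aeval θ : JetPoly →ₐ[ℝ] ℝ) = (EulerDarboux.locEval t).comp toLoc := by
    apply algHom_ext
    intro i
    rw [aeval_X, AlgHom.comp_apply, h]
  rw [← AlgHom.comp_apply, ← this, aeval_eq_eval]

/-- Every choice of internal coordinates off `x + y = 0` comes from a point of the prolongation. -/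
theorem exists_point {t : JetPoint} (ht : t .x + t .y ≠ 0) :
    ∃ θ ∈ prolongation, ∀ p, eval θ p = EulerDarboux.locEval t (toLoc p) := by
  have key := eval_eq_locEval_of_coord (t := t)
    (θ := fun v => EulerDarboux.locEval t (toLoc (X v))) fun _ => rfl
  refine ⟨_, ⟨by simpa using ht, fun h k => ?_⟩, key⟩
  rw [key]
  exact (spurious_F h k).locEval ht

/-- Leibniz rule for the factor `x + y`, whose second derivatives vanish. The truncated `k - 1` is
harmless at `k = 0`, where its coefficient is zero. -/
theorem totalY_iterate_F (k : ℕ) : polyTotalY^[k] F =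
    (X .x + X .y) * (X (.u 2 k) + X (.u 0 (k + 2))) + X (.u 1 k) + X (.u 0 (k + 1)) +
      (k : JetPoly) * (X (.u 2 (k - 1)) + X (.u 0 (k + 1))) := by
  induction k with
  | zero => simp [F]
  | succ k ih =>
    rw [Function.iterate_succ_apply', ih]
    cases k <;>
    · simp only [map_add, Derivation.leibniz, smul_eq_mul, polyTotalY_x, polyTotalY_y, polyTotalY_u,
        Derivation.map_natCast]
      push_cast
      simp
      ring

theorem totalX_totalY_iterate_F (h k : ℕ) : polyTotalX^[h] (polyTotalY^[k] F) =
    (X .x + X .y) * (X (.u (h + 2) k) + X (.u h (k + 2))) + X (.u (h + 1) k) + X (.u h (k + 1)) +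
      (k : JetPoly) * (X (.u (h + 2) (k - 1)) + X (.u h (k + 1))) +
      (h : JetPoly) * (X (.u (h + 1) k) + X (.u (h - 1) (k + 2))) := by
  induction h with
  | zero => simp [totalY_iterate_F]
  | succ h ih =>
    rw [Function.iterate_succ_apply', ih]
    cases h <;>
    · simp only [map_add, Derivation.leibniz, smul_eq_mul, polyTotalX_x, polyTotalX_y, polyTotalX_u,
        Derivation.map_natCast]
      push_cast
      simp
      ring

/-- On the prolongation the coordinates are given by the internal ones. -/
theorem eval_eq_locEval {θ : JetPoint} (hθ : θ ∈ prolongation) (p : JetPoly) :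
    eval θ p = EulerDarboux.locEval θ (toLoc p) := by
  obtain ⟨hs, hF⟩ := hθ
  -- Outer induction on the `x`-order, inner on the `y`-order. `D_x^n D_y^k F = 0` determines
  -- `u_{(n+2)x,ky}`, whose coefficient is `x + y`, from lower `x`-orders and, for `k > 0`, from
  -- `u_{(n+2)x,(k-1)y}`. The internal expressions satisfy the same relation, so the two values
  -- agree.
  have key : ∀ n h, h ≤ n → ∀ k, θ (.u h k) = EulerDarboux.locEval θ (toLoc (X (.u h k))) := by
    intro n
    induction n with
    | zero => intro h hh k; obtain rfl : h = 0 := by omega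
              simp
    | succ n ihn =>
      intro h hh
      obtain hh | rfl := Nat.le_succ_iff.mp hh
      · exact ihn h hh
      obtain _ | n := n
      · intro k; simp
      intro k
      induction k with
      | zero =>
        have h1 := hF n 0
        have h2 := (spurious_F n 0).locEval hs
        rw [totalX_totalY_iterate_F] at h1 h2
        simp only [map_add, map_mul, eval_X, map_natCast, Nat.cast_zero, zero_mul, add_zero] at h1 h2
        simp only [toLoc_x, toLoc_y, locEval_loc, ← ihn n (by omega), ← ihn (n + 1) (by omega),
          ← ihn (n - 1) (by omega)] at h2
        apply mul_left_cancel₀ hs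
        linear_combination h1 - h2
      | succ k ihk =>
        have h1 := hF n (k + 1)
        have h2 := (spurious_F n (k + 1)).locEval hs
        rw [totalX_totalY_iterate_F] at h1 h2
        simp only [map_add, map_mul, eval_X, map_natCast, Nat.add_sub_cancel] at h1 h2
        simp only [toLoc_x, toLoc_y, locEval_loc, ← ihk, ← ihn n (by omega), ← ihn (n + 1) (by omega),
          ← ihn (n - 1) (by omega)] at h2
        apply mul_left_cancel₀ hs
        linear_combination h1 - h2
  apply eval_eq_locEval_of_coord
  rintro (_ | _ | ⟨h, k⟩)
  · simp
  · simp
  · exact key h h le_rfl k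

end
/-! ### The restriction of rational functions to the prolongation -/

section
open MvPolynomial

/-- The rational function `1 / (x + y)`. -/
def invSum : JetRat := (coord .x + coord .y)⁻¹

theorem sum_ne_zero : coord .x + coord .y ≠ 0 := by
  rw [coord, coord, ← map_add]
  apply algebraMap_ne
  intro h
  simpa using congrArg (eval fun _ => (1 : ℝ)) h

theorem sum_mul_invSum : (coord .x + coord .y) * invSum = 1 := mul_inv_cancel₀ sum_ne_zero

theorem invSum_ne_zero : invSum ≠ 0 := inv_ne_zero sum_ne_zero

/-- The total derivative `D_y` in internal coordinates, on rational functions. -/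
def intY : Derivation ℝ JetRat JetRat :=
  vectorField fun v => match v with
    | .x => 0
    | .y => 1
    | .u 0 k => coord (.u 0 (k + 1))
    | .u 1 k => coord (.u 1 (k + 1))
    | .u (_ + 2) _ => 0

/-- The internal expression of `u_xx` as a rational function. -/
def intXX : JetRat := -coord (.u 0 2) - invSum * (coord (.u 1 0) + coord (.u 0 1))

/-- The total derivative `D_x` in internal coordinates, on rational functions. -/
def intX : Derivation ℝ JetRat JetRat :=
  vectorField fun v => match v with
    | .x => 1
    | .y => 0
    | .u 0 k => coord (.u 1 k)
    | .u 1 k => intY^[k] intXX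
    | .u (_ + 2) _ => 0

@[simp] theorem intY_x : intY (coord .x) = 0 := vectorField_coord _ _
@[simp] theorem intY_y : intY (coord .y) = 1 := vectorField_coord _ _
@[simp] theorem intY_v (k : ℕ) : intY (coord (.u 0 k)) = coord (.u 0 (k + 1)) :=
  vectorField_coord _ _
@[simp] theorem intY_w (k : ℕ) : intY (coord (.u 1 k)) = coord (.u 1 (k + 1)) :=
  vectorField_coord _ _
@[simp] theorem intY_high (h k : ℕ) : intY (coord (.u (h + 2) k)) = 0 := vectorField_coord _ _
@[simp] theorem intX_x : intX (coord .x) = 1 := vectorField_coord _ _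
@[simp] theorem intX_y : intX (coord .y) = 0 := vectorField_coord _ _
@[simp] theorem intX_v (k : ℕ) : intX (coord (.u 0 k)) = coord (.u 1 k) := vectorField_coord _ _
@[simp] theorem intX_w (k : ℕ) : intX (coord (.u 1 k)) = intY^[k] intXX := vectorField_coord _ _
@[simp] theorem intX_high (h k : ℕ) : intX (coord (.u (h + 2) k)) = 0 := vectorField_coord _ _

@[simp] theorem intY_invSum : intY invSum = -invSum ^ 2 := by
  simp [invSum, Derivation.leibniz_inv]

@[simp] theorem intX_invSum : intX invSum = -invSum ^ 2 := by
  simp [invSum, Derivation.leibniz_inv]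

/-- Two derivations on rational functions that agree on a set of coordinates agree on the field
it generates. -/
theorem derivation_eqOn_adjoin {M : Type*} [AddCommGroup M] [Module ℝ M] [Module JetRat M]
    {D₁ D₂ : Derivation ℝ JetRat M} {s : Set JetRat} (h : Set.EqOn D₁ D₂ s) :
    Set.EqOn D₁ D₂ (IntermediateField.adjoin ℝ s) := by
  intro g hg
  induction hg using IntermediateField.adjoin_induction with
  | mem x hx => exact h hx
  | algebraMap x => simp
  | add x y _ _ hx hy => rw [map_add, map_add, hx, hy]
  | inv x _ hx => rw [Derivation.leibniz_inv, Derivation.leibniz_inv, hx]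
  | mul x y _ _ hx hy => rw [Derivation.leibniz, Derivation.leibniz, hx, hy]

theorem algebraMap_mem_adjoin {p : JetPoly} {S : Set JetVar} (hp : p ∈ supported ℝ S) :
    algebraMap JetPoly JetRat p ∈ IntermediateField.adjoin ℝ (coord '' S) := by
  rw [supported_eq_adjoin_X] at hp
  induction hp using Algebra.adjoin_induction with
  | mem x hx =>
    obtain ⟨v, hv, rfl⟩ := hx
    exact IntermediateField.subset_adjoin _ _ ⟨v, hv, rfl⟩
  | algebraMap r =>
    rw [← IsScalarTower.algebraMap_apply ℝ JetPoly JetRat]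
    exact IntermediateField.algebraMap_mem _ _
  | add x y _ _ hx hy => rw [map_add]; exact add_mem hx hy
  | mul x y _ _ hx hy => rw [map_mul]; exact mul_mem hx hy

theorem adjoin_coord_univ : IntermediateField.adjoin ℝ (Set.range coord) = ⊤ := by
  rw [eq_top_iff]
  intro g _
  obtain ⟨p, q, -, rfl⟩ := IsFractionRing.div_surjective (A := JetPoly) g
  rw [← Set.image_univ]
  exact div_mem (algebraMap_mem_adjoin (by simp)) (algebraMap_mem_adjoin (by simp))

theorem derivation_ext_coord {M : Type*} [AddCommGroup M] [Module ℝ M] [Module JetRat M]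
    {D₁ D₂ : Derivation ℝ JetRat M} (h : ∀ v, D₁ (coord v) = D₂ (coord v)) : D₁ = D₂ := by
  apply Derivation.ext
  intro g
  apply derivation_eqOn_adjoin (s := Set.range coord)
  · rintro _ ⟨v, rfl⟩
    exact h v
  · rw [adjoin_coord_univ]
    trivial

theorem derivation_comm_of_coord {D₁ D₂ : Derivation ℝ JetRat JetRat}
    (h : ∀ v, D₁ (D₂ (coord v)) = D₂ (D₁ (coord v))) (g : JetRat) : D₁ (D₂ g) = D₂ (D₁ g) := by
  have : ⁅D₁, D₂⁆ = 0 := derivation_ext_coord fun v => by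
    rw [Derivation.commutator_apply, h, sub_self]
    rfl
  simpa [Derivation.commutator_apply, sub_eq_zero] using congrArg (· g) this

theorem intX_intY (g : JetRat) : intX (intY g) = intY (intX g) := by
  apply derivation_comm_of_coord
  rintro (_ | _ | ⟨_ | _ | h, k⟩) <;>
    simp [-Function.iterate_succ, Function.iterate_succ_apply']

/-! ### From localized polynomials to rational functions -/

/-- Locally defined functions as rational functions. -/
def locToRat : LocPoly →ₐ[ℝ] JetRat :=
  aeval fun v => match v with
    | none => invSum
    | some v => coord v

@[simp] theorem locToRat_inv : locToRat locInv = invSum := aeval_X _ _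
@[simp] theorem locToRat_loc (v : JetVar) : locToRat (loc v) = coord v := aeval_X _ _

theorem locToRat_locY (g : LocPoly) : locToRat (locY g) = intY (locToRat g) := by
  apply intertwine
  rintro (_ | _ | _ | ⟨_ | _ | h, k⟩)
  · rw [← locInv]; simp
  all_goals rw [← loc]; simp

theorem locToRat_locX (g : LocPoly) : locToRat (locX g) = intX (locToRat g) := by
  apply intertwine
  rintro (_ | _ | _ | ⟨_ | _ | h, k⟩)
  · rw [← locInv]; simp
  all_goals rw [← loc]; simp
  rw [Function.Semiconj.iterate_right (f := locToRat) (ga := locY) (gb := intY) locToRat_locY k]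
  simp [locXX, intXX]

/-- A locally defined function becomes polynomial after multiplication with a power of `x + y`. -/
theorem exists_numerator (g : LocPoly) : ∃ (N : ℕ) (P : JetPoly),
    locToRat g * (coord .x + coord .y) ^ N = algebraMap JetPoly JetRat P ∧
    ∀ t : JetPoint, t .x + t .y ≠ 0 → locEval t g * (t .x + t .y) ^ N = eval t P := by
  induction g using MvPolynomial.induction_on with
  | C a =>
    refine ⟨0, C a, ?_, fun t _ => ?_⟩
    · rw [← algebraMap_eq, ← algebraMap_eq, AlgHom.commutes,
        ← IsScalarTower.algebraMap_apply ℝ JetPoly JetRat, pow_zero, mul_one]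
    · rw [← algebraMap_eq, ← algebraMap_eq, AlgHom.commutes]
      simp
  | add p q hp hq =>
    obtain ⟨N, P, hP, hP'⟩ := hp
    obtain ⟨M, Q, hQ, hQ'⟩ := hq
    refine ⟨N + M, P * (X .x + X .y) ^ M + Q * (X .x + X .y) ^ N, ?_, fun t ht => ?_⟩
    · simp only [map_add, map_mul, map_pow, ← hP, ← hQ, coord]
      ring
    · simp only [map_add, map_mul, map_pow, ← hP' t ht, ← hQ' t ht, eval_X]
      ring
  | mul_X p i hp =>
    obtain ⟨N, P, hP, hP'⟩ := hp
    cases i with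
    | none =>
      refine ⟨N + 1, P, ?_, fun t ht => ?_⟩
      · rw [map_mul, ← locInv, locToRat_inv, ← hP]
        linear_combination (locToRat p * (coord .x + coord .y) ^ N) * sum_mul_invSum
      · rw [map_mul, ← locInv, locEval_inv, ← hP' t ht]
        field_simp
        ring
    | some v =>
      refine ⟨N, P * X v, ?_, fun t ht => ?_⟩
      · rw [map_mul, ← loc, locToRat_loc, map_mul, ← hP, coord]
        ring
      · rw [map_mul, ← loc, locEval_loc, map_mul, ← hP' t ht, eval_X]
        ring

theorem locToRat_eq_zero_iff (g : LocPoly) :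
    locToRat g = 0 ↔ ∀ t : JetPoint, t .x + t .y ≠ 0 → locEval t g = 0 := by
  obtain ⟨N, P, hP, hP'⟩ := exists_numerator g
  constructor
  · intro h t ht
    have hP0 : P = 0 := IsFractionRing.injective JetPoly JetRat (by rw [← hP, h, zero_mul, map_zero])
    have := hP' t ht
    rw [hP0, map_zero] at this
    exact (mul_eq_zero.mp this).resolve_right (pow_ne_zero _ ht)
  · intro h
    -- The extra factor makes the product vanish on `x + y = 0` too, so it is zero at every real
    -- point and hence as a polynomial.
    have hzero : P * (X .x + X .y) = 0 := by
      apply MvPolynomial.funext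
      intro t
      by_cases ht : t .x + t .y = 0
      · simp [ht]
      · rw [map_mul, ← hP' t ht, h t ht]
        simp
    have hs : (X .x + X .y : JetPoly) ≠ 0 := by
      intro h0
      apply sum_ne_zero
      rw [coord, coord, ← map_add, h0, map_zero]
    rw [(mul_eq_zero.mp hzero).resolve_right hs, map_zero] at hP
    exact (mul_eq_zero.mp hP).resolve_right (pow_ne_zero _ sum_ne_zero)

/-- The restriction of polynomial functions to the prolongation, as rational functions of the
internal coordinates. -/
def restrict : JetPoly →ₐ[ℝ] JetRat := locToRat.comp toLoc

theorem restrict_eq_zero_iff (p : JetPoly) :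
    restrict p = 0 ↔ ∀ θ ∈ prolongation, eval θ p = 0 := by
  rw [restrict, AlgHom.comp_apply, locToRat_eq_zero_iff]
  constructor
  · intro h θ hθ
    rw [eval_eq_locEval hθ]
    exact h θ hθ.1
  · intro h t ht
    obtain ⟨θ, hθ, key⟩ := exists_point ht
    rw [← key]
    exact h θ hθ

theorem restrict_ne_zero_iff (p : JetPoly) :
    restrict p ≠ 0 ↔ ∃ θ ∈ prolongation, eval θ p ≠ 0 := by
  rw [Ne, restrict_eq_zero_iff]
  push Not
  rfl

theorem restrict_polyTotalX (p : JetPoly) : restrict (polyTotalX p) = intX (restrict p) := by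
  simp only [restrict, AlgHom.comp_apply, toLoc_polyTotalX, locToRat_locX]

theorem restrict_polyTotalY (p : JetPoly) : restrict (polyTotalY p) = intY (restrict p) := by
  simp only [restrict, AlgHom.comp_apply, toLoc_polyTotalY, locToRat_locY]

/-! ### Restriction of rational functions as a relation -/

/-- `g` is the expression of the restriction of `r` to the prolongation in internal coordinates. -/
def HasRestriction (r g : JetRat) : Prop :=
  ∃ p q : JetPoly, restrict q ≠ 0 ∧ r = algebraMap JetPoly JetRat p / algebraMap JetPoly JetRat q ∧
    g = restrict p / restrict q

theorem ne_zero_of_restrict {q : JetPoly} (hq : restrict q ≠ 0) : algebraMap JetPoly JetRat q ≠ 0 :=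
  algebraMap_ne fun h => hq (by rw [h, map_zero])

theorem HasRestriction.unique {r g g' : JetRat} (h : HasRestriction r g)
    (h' : HasRestriction r g') : g = g' := by
  obtain ⟨p, q, hq, rfl, rfl⟩ := h
  obtain ⟨p', q', hq', h, rfl⟩ := h'
  rw [div_eq_div_iff (ne_zero_of_restrict hq) (ne_zero_of_restrict hq'), ← map_mul, ← map_mul] at h
  rw [div_eq_div_iff hq hq', ← map_mul, ← map_mul, IsFractionRing.injective JetPoly JetRat h]

theorem hasRestriction_algebraMap (p : JetPoly) :
    HasRestriction (algebraMap JetPoly JetRat p) (restrict p) :=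
  ⟨p, 1, by simp, by simp, by simp⟩

theorem HasRestriction.add {r g r' g' : JetRat} (h : HasRestriction r g)
    (h' : HasRestriction r' g') : HasRestriction (r + r') (g + g') := by
  obtain ⟨p, q, hq, rfl, rfl⟩ := h
  obtain ⟨p', q', hq', rfl, rfl⟩ := h'
  have := ne_zero_of_restrict hq
  have := ne_zero_of_restrict hq'
  refine ⟨p * q' + q * p', q * q', by simp [hq, hq'], ?_, ?_⟩
  · rw [div_add_div _ _ ‹_› ‹_›]; simp
  · rw [div_add_div _ _ hq hq']; simp

theorem HasRestriction.mul {r g r' g' : JetRat} (h : HasRestriction r g)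
    (h' : HasRestriction r' g') : HasRestriction (r * r') (g * g') := by
  obtain ⟨p, q, hq, rfl, rfl⟩ := h
  obtain ⟨p', q', hq', rfl, rfl⟩ := h'
  refine ⟨p * p', q * q', by simp [hq, hq'], ?_, ?_⟩
  · rw [div_mul_div_comm]; simp
  · rw [div_mul_div_comm]; simp

theorem HasRestriction.inv {r g : JetRat} (h : HasRestriction r g) (hg : g ≠ 0) :
    HasRestriction r⁻¹ g⁻¹ := by
  obtain ⟨p, q, hq, rfl, rfl⟩ := h
  exact ⟨q, p, fun hp => hg (by rw [hp, zero_div]), inv_div _ _, inv_div _ _⟩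

theorem HasRestriction.neg {r g : JetRat} (h : HasRestriction r g) : HasRestriction (-r) (-g) := by
  obtain ⟨p, q, hq, rfl, rfl⟩ := h
  exact ⟨-p, q, hq, by rw [map_neg, neg_div], by rw [map_neg, neg_div]⟩

theorem HasRestriction.of_derivation {r g : JetRat} (h : HasRestriction r g)
    {D : Derivation ℝ JetRat JetRat} {d : Derivation ℝ JetPoly JetPoly}
    {D' : Derivation ℝ JetRat JetRat}
    (hD : ∀ p, D (algebraMap JetPoly JetRat p) = algebraMap JetPoly JetRat (d p))
    (hD' : ∀ p, restrict (d p) = D' (restrict p)) : HasRestriction (D r) (D' g) := by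
  obtain ⟨p, q, hq, rfl, rfl⟩ := h
  refine ⟨q * d p - p * d q, q ^ 2, by simp [hq], ?_, ?_⟩
  · rw [Derivation.leibniz_div, hD, hD]
    simp only [smul_eq_mul, map_sub, map_mul, map_pow]
    rw [div_eq_inv_mul, inv_pow]
  · rw [Derivation.leibniz_div, ← hD', ← hD']
    simp only [smul_eq_mul, map_sub, map_mul, map_pow]
    rw [div_eq_inv_mul, inv_pow]

theorem totalX_algebraMap (p : JetPoly) :
    totalX (algebraMap JetPoly JetRat p) = algebraMap JetPoly JetRat (polyTotalX p) := by
  symm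
  refine intertwine (IsScalarTower.toAlgHom ℝ JetPoly JetRat) polyTotalX totalX ?_ p
  intro i
  rw [IsScalarTower.coe_toAlgHom', ← coord, totalX, vectorField_coord]
  obtain _ | _ | ⟨h, k⟩ := i
  · rw [polyTotalX_x]; simp
  · rw [polyTotalX_y]; simp
  · rw [polyTotalX_u]; rfl

theorem totalY_algebraMap (p : JetPoly) :
    totalY (algebraMap JetPoly JetRat p) = algebraMap JetPoly JetRat (polyTotalY p) := by
  symm
  refine intertwine (IsScalarTower.toAlgHom ℝ JetPoly JetRat) polyTotalY totalY ?_ p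
  intro i
  rw [IsScalarTower.coe_toAlgHom', ← coord, totalY, vectorField_coord]
  obtain _ | _ | ⟨h, k⟩ := i
  · rw [polyTotalY_x]; simp
  · rw [polyTotalY_y]; simp
  · rw [polyTotalY_u]; rfl

theorem HasRestriction.totalX {r g : JetRat} (h : HasRestriction r g) :
    HasRestriction (totalX r) (intX g) :=
  h.of_derivation totalX_algebraMap restrict_polyTotalX

theorem HasRestriction.totalY {r g : JetRat} (h : HasRestriction r g) :
    HasRestriction (totalY r) (intY g) :=
  h.of_derivation totalY_algebraMap restrict_polyTotalY

theorem hasRestriction_x : HasRestriction (coord .x) (coord .x) := by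
  convert! hasRestriction_algebraMap (X .x)
  simp [restrict]
theorem hasRestriction_y : HasRestriction (coord .y) (coord .y) := by
  convert! hasRestriction_algebraMap (X .y)
  simp [restrict]
theorem hasRestriction_v (k : ℕ) : HasRestriction (coord (.u 0 k)) (coord (.u 0 k)) := by
  convert! hasRestriction_algebraMap (X (.u 0 k))
  simp [restrict]
theorem hasRestriction_w (k : ℕ) : HasRestriction (coord (.u 1 k)) (coord (.u 1 k)) := by
  convert! hasRestriction_algebraMap (X (.u 1 k))
  simp [restrict]

theorem hasRestriction_baseField {a : JetRat} (ha : a ∈ baseField) : HasRestriction a a := by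
  induction ha using IntermediateField.adjoin_induction with
  | mem x hx =>
    obtain rfl | rfl := hx
    exacts [hasRestriction_x, hasRestriction_y]
  | algebraMap r =>
    rw [IsScalarTower.algebraMap_apply ℝ JetPoly JetRat]
    have := hasRestriction_algebraMap (algebraMap ℝ JetPoly r)
    rwa [AlgHom.commutes, IsScalarTower.algebraMap_apply ℝ JetPoly JetRat] at this
  | add x y _ _ hx hy => exact hx.add hy
  | inv x _ hx =>
    by_cases h0 : x = 0
    · rwa [h0, inv_zero, ← h0]
    · exact hx.inv h0
  | mul x y _ _ hx hy => exact hx.mul hy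

theorem Restricts.hasRestriction {r : JetRat} (h : Restricts r) : ∃ g, HasRestriction r g := by
  obtain ⟨p, q, hq, rfl⟩ := h
  exact ⟨_, p, q, (restrict_ne_zero_iff q).mpr hq, rfl, rfl⟩

theorem vanishesOnProlongation_iff {r : JetRat} :
    VanishesOnProlongation r ↔ HasRestriction r 0 := by
  constructor
  · rintro ⟨p, q, hq, hp, rfl⟩
    exact ⟨p, q, (restrict_ne_zero_iff q).mpr hq, rfl, by rw [(restrict_eq_zero_iff p).mpr hp, zero_div]⟩
  · rintro ⟨p, q, hq, rfl, h⟩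
    exact ⟨p, q, (restrict_ne_zero_iff q).mp hq,
      (restrict_eq_zero_iff p).mp ((div_eq_zero_iff.mp h.symm).resolve_right hq), rfl⟩

/-- `F` is linear in the jet variables and `X_φ` annihilates `x` and `y`, so `X_φ` merely replaces
`u` by `φ` in `F`. -/
theorem evolutionary_F (φ : JetRat) : evolutionary φ (algebraMap JetPoly JetRat F) =
    (coord .x + coord .y) * (totalX (totalX φ) + totalY (totalY φ)) + totalX φ + totalY φ := by
  rw [evolutionary, vectorField_algebraMap, F]
  simp only [map_add, Derivation.leibniz, mkDerivation_X, Algebra.smul_def, coord]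
  simp

/-- The linearized equation satisfied by the restriction of a symmetry. -/
theorem IsRationalSymmetry.linearized {φ g : JetRat} (hφ : IsRationalSymmetry φ)
    (hg : HasRestriction φ g) :
    (coord .x + coord .y) * (intX (intX g) + intY (intY g)) + intX g + intY g = 0 := by
  have h := vanishesOnProlongation_iff.mp hφ.2
  rw [evolutionary_F] at h
  exact HasRestriction.unique
    ((((hasRestriction_x.add hasRestriction_y).mul
      (hg.totalX.totalX.add hg.totalY.totalY)).add hg.totalX).add hg.totalY) h

end
/-! ### Partial derivatives on rational functions -/

section
open MvPolynomial

open Classical in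
/-- The partial derivative with respect to a jet coordinate. -/
def partialDeriv (a : JetVar) : Derivation ℝ JetRat JetRat :=
  vectorField fun v => if v = a then 1 else 0

theorem partialDeriv_self (a : JetVar) : partialDeriv a (coord a) = 1 := by
  rw [partialDeriv, vectorField_coord, if_pos rfl]

theorem partialDeriv_of_ne {a v : JetVar} (h : v ≠ a) : partialDeriv a (coord v) = 0 := by
  rw [partialDeriv, vectorField_coord, if_neg h]

theorem partialDeriv_comm (a b : JetVar) (g : JetRat) :
    partialDeriv a (partialDeriv b g) = partialDeriv b (partialDeriv a g) := by
  apply derivation_comm_of_coord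
  intro v
  simp only [partialDeriv, vectorField_coord]
  split_ifs <;> simp

theorem partialDeriv_algebraMap (a : JetVar) (p : JetPoly) :
    partialDeriv a (algebraMap JetPoly JetRat p) = algebraMap JetPoly JetRat (pderiv a p) := by
  classical
  symm
  refine intertwine (IsScalarTower.toAlgHom ℝ JetPoly JetRat) (pderiv a) (partialDeriv a) ?_ p
  intro i
  rw [IsScalarTower.coe_toAlgHom', ← coord, pderiv_X]
  by_cases h : i = a
  · subst h
    rw [partialDeriv_self, Pi.single_eq_same, map_one]
  · rw [partialDeriv_of_ne h, Pi.single_eq_of_ne' (Ne.symm h), map_zero]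

theorem notMem_vars_of_pderiv_eq_zero {σ : Type*} {i : σ} {p : MvPolynomial σ ℝ}
    (h : pderiv i p = 0) : i ∉ p.vars := by
  intro hi
  rw [mem_vars_iff_mem_support] at hi
  obtain ⟨m, hm, him⟩ := hi
  have h1 := coeff_pderiv (i := i) p (m - Finsupp.single i 1)
  have h2 : m - Finsupp.single i 1 + Finsupp.single i 1 = m :=
    tsub_add_cancel_of_le (by
      rw [Finsupp.single_le_iff]
      exact Nat.one_le_iff_ne_zero.mpr (Finsupp.mem_support_iff.mp him))
  rw [h, coeff_zero, h2] at h1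
  rcases mul_eq_zero.mp h1.symm with h3 | h3
  · exact (mem_support_iff.mp hm) h3
  · exact absurd h3 (by positivity)

/-- A nonzero multiple of `q` has at least the degree of `q` in the variable `i`, whereas
differentiation lowers that degree. -/
theorem pderiv_eq_zero_of_dvd {σ : Type*} {i : σ} {q : MvPolynomial σ ℝ}
    (h : q ∣ pderiv i q) : pderiv i q = 0 := by
  by_contra h0
  obtain ⟨c, hc⟩ := h
  have hq : q ≠ 0 := by rintro rfl; simp at h0
  have hc0 : c ≠ 0 := by rintro rfl; simp at hc; exact h0 hc
  have hdeg : degreeOf i q ≤ degreeOf i (pderiv i q) := by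
    rw [hc, degreeOf_mul_eq hq hc0]
    exact Nat.le_add_right _ _
  have hpos : 0 < degreeOf i q := by
    by_contra hd
    apply h0
    apply pderiv_eq_zero_of_notMem_vars
    intro hi
    obtain ⟨m, hm, him⟩ := (mem_vars_iff_mem_support i).mp hi
    have := monomial_le_degreeOf i hm
    have := Finsupp.mem_support_iff.mp him
    omega
  refine absurd hdeg (not_le.mpr ((degreeOf_lt_iff hpos).mpr fun m hm => ?_))
  have h1 : m + Finsupp.single i 1 ∈ q.support := by
    rw [mem_support_iff] at hm ⊢
    intro h2
    rw [coeff_pderiv, h2, zero_mul] at hm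
    exact hm rfl
  have := monomial_le_degreeOf i h1
  simp at this
  omega

/-- A rational function lies in the field generated by the coordinates on which it depends. -/
theorem mem_adjoin_of_partialDeriv_eq_zero {g : JetRat} {S : Set JetVar}
    (h : ∀ a ∉ S, partialDeriv a g = 0) : g ∈ IntermediateField.adjoin ℝ (coord '' S) := by
  obtain ⟨p, q, hpq, hg⟩ := IsFractionRing.exists_reduced_fraction JetPoly g
  have hq0 := algebraMap_ne (K := JetRat) (nonZeroDivisors.ne_zero q.2)
  have hg' : g = algebraMap JetPoly JetRat p / algebraMap JetPoly JetRat q := by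
    rw [← hg, IsFractionRing.mk'_eq_div]
  have key : ∀ a ∉ S, pderiv a (q : JetPoly) = 0 ∧ pderiv a p = 0 := by
    intro a ha
    have h1 := h a ha
    rw [hg', Derivation.leibniz_div, partialDeriv_algebraMap, partialDeriv_algebraMap, smul_eq_mul,
      mul_eq_zero, or_iff_right (pow_ne_zero _ (inv_ne_zero hq0)), smul_eq_mul, smul_eq_mul,
      ← map_mul, ← map_mul, ← map_sub] at h1
    have h2 : (q : JetPoly) * pderiv a p - p * pderiv a (q : JetPoly) = 0 :=
      IsFractionRing.injective JetPoly JetRat (by rw [h1, map_zero])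
    -- From `q ∂p = p ∂q` and coprimality, `q` divides `∂q`. This is why a reduced fraction was
    -- chosen.
    have h3 : pderiv a (q : JetPoly) = 0 := by
      apply pderiv_eq_zero_of_dvd
      apply hpq.symm.dvd_of_dvd_mul_left
      exact ⟨pderiv a p, (sub_eq_zero.mp h2).symm⟩
    rw [h3, mul_zero, sub_zero] at h2
    exact ⟨h3, (mul_eq_zero.mp h2).resolve_left (nonZeroDivisors.ne_zero q.2)⟩
  have hsupp : ∀ r : JetPoly, (∀ a ∉ S, pderiv a r = 0) → r ∈ supported ℝ S := by
    intro r hr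
    rw [mem_supported]
    intro a ha
    by_contra haS
    exact notMem_vars_of_pderiv_eq_zero (hr a haS) ha
  rw [hg']
  exact div_mem (algebraMap_mem_adjoin (hsupp p fun a ha => (key a ha).2))
    (algebraMap_mem_adjoin (hsupp q fun a ha => (key a ha).1))

/-- A family of derivations that is locally finite on coordinates is locally finite. -/
theorem finite_setOf_derivation_ne_zero {M ι : Type*} [AddCommGroup M] [Module ℝ M]
    [Module JetRat M] (D : ι → Derivation ℝ JetRat M)
    (h : ∀ v, {i | D i (coord v) ≠ 0}.Finite) (g : JetRat) : {i | D i g ≠ 0}.Finite := by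
  have hg : g ∈ IntermediateField.adjoin ℝ (Set.range coord) := by
    rw [adjoin_coord_univ]
    trivial
  induction hg using IntermediateField.adjoin_induction with
  | mem x hx =>
    obtain ⟨v, rfl⟩ := hx
    exact h v
  | algebraMap x => simp
  | add x y _ _ hx hy =>
    refine (hx.union hy).subset fun i hi => ?_
    by_contra hn
    simp only [Set.mem_union, Set.mem_ofPred_eq, not_or, not_not] at hn
    exact hi (by rw [map_add, hn.1, hn.2, add_zero])
  | inv x _ hx =>
    refine hx.subset fun i hi => ?_
    intro hn
    exact hi (by rw [Derivation.leibniz_inv, hn, smul_zero])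
  | mul x y _ _ hx hy =>
    refine (hx.union hy).subset fun i hi => ?_
    by_contra hn
    simp only [Set.mem_union, Set.mem_ofPred_eq, not_or, not_not] at hn
    exact hi (by rw [Derivation.leibniz, hn.1, hn.2, smul_zero, smul_zero, add_zero])

theorem exists_order (g : JetRat) :
    ∃ N, ∀ j, N ≤ j → partialDeriv (.u 0 j) g = 0 ∧ partialDeriv (.u 1 j) g = 0 := by
  have hfin := finite_setOf_derivation_ne_zero partialDeriv (fun v => by
    refine (Set.finite_singleton v).subset fun a ha => ?_
    by_contra hne
    exact ha (partialDeriv_of_ne (Ne.symm hne))) g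
  have h0 : {j | partialDeriv (.u 0 j) g ≠ 0}.Finite :=
    hfin.preimage (f := JetVar.u 0) fun a _ b _ h => by simpa using h
  have h1 : {j | partialDeriv (.u 1 j) g ≠ 0}.Finite :=
    hfin.preimage (f := JetVar.u 1) fun a _ b _ h => by simpa using h
  obtain ⟨N, hN⟩ := (h0.union h1).bddAbove
  refine ⟨N + 1, fun j hj => ?_⟩
  by_contra hn
  have : j ≤ N := hN (by
    by_contra hm
    simp only [Set.mem_union, Set.mem_ofPred_eq, not_or, not_not] at hm
    exact hn hm)
  omega

end

/-! ### Complexification -/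

/-- Complex rational functions on the infinite jet space. -/
abbrev CJetRat : Type := QuadraticAlgebra JetRat (-1) 0

/-- The imaginary unit. -/
def imag : CJetRat := QuadraticAlgebra.omega

/-- Real rational functions as complex ones. -/
abbrev toC : JetRat →+* CJetRat := algebraMap JetRat CJetRat

theorem imag_sq : imag ^ 2 = -1 := by
  ext <;> simp [imag, sq, QuadraticAlgebra.re_one, QuadraticAlgebra.im_one]

theorem eq_re_add_im (g : CJetRat) : g = toC g.re + toC g.im * imag := by
  ext <;> simp [imag]

/-- The complex linear extension of a derivation. -/
def complexify (D : Derivation ℝ JetRat JetRat) : Derivation ℝ CJetRat CJetRat :=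
  Derivation.mk'
    { toFun := fun g => ⟨D g.re, D g.im⟩
      map_add' := fun a b => by ext <;> simp
      map_smul' := fun c a => by ext <;> simp }
    (fun a b => by ext <;> simp <;> ring)

theorem complexify_apply (D : Derivation ℝ JetRat JetRat) (g : CJetRat) :
    complexify D g = ⟨D g.re, D g.im⟩ := rfl

@[simp] theorem complexify_toC (D : Derivation ℝ JetRat JetRat) (g : JetRat) :
    complexify D (toC g) = toC (D g) := by
  ext <;> simp [complexify_apply]

@[simp] theorem complexify_imag (D : Derivation ℝ JetRat JetRat) :
    complexify D imag = 0 := by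
  ext <;> simp [complexify_apply, imag]

theorem complexify_eq_zero_iff {D : Derivation ℝ JetRat JetRat} {g : CJetRat} :
    complexify D g = 0 ↔ D g.re = 0 ∧ D g.im = 0 := by
  rw [complexify_apply, QuadraticAlgebra.ext_iff]
  rfl

theorem complexify_comm {D₁ D₂ : Derivation ℝ JetRat JetRat} (h : ∀ g, D₁ (D₂ g) = D₂ (D₁ g))
    (g : CJetRat) : complexify D₁ (complexify D₂ g) = complexify D₂ (complexify D₁ g) := by
  ext <;> simp [complexify_apply, h]

/-- The complex vector field with given values on the coordinates. -/
def complexField (c : JetVar → CJetRat) : Derivation ℝ CJetRat CJetRat :=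
  complexify (vectorField fun v => (c v).re) + imag • complexify (vectorField fun v => (c v).im)

@[simp] theorem complexField_coord (c : JetVar → CJetRat) (v : JetVar) :
    complexField c (toC (coord v)) = c v := by
  rw [complexField, Derivation.add_apply, Derivation.smul_apply, complexify_toC, complexify_toC,
    vectorField_coord, vectorField_coord, smul_eq_mul, mul_comm, ← eq_re_add_im]

@[simp] theorem complexField_imag (c : JetVar → CJetRat) : complexField c imag = 0 := by
  simp [complexField]

theorem complex_derivation_eqOn {D₁ D₂ : Derivation ℝ CJetRat CJetRat} {S : Set JetVar}
    (hi : D₁ imag = D₂ imag) (h : ∀ v ∈ S, D₁ (toC (coord v)) = D₂ (toC (coord v))) {g : CJetRat}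
    (hre : g.re ∈ IntermediateField.adjoin ℝ (coord '' S))
    (him : g.im ∈ IntermediateField.adjoin ℝ (coord '' S)) : D₁ g = D₂ g := by
  have key : ∀ r ∈ IntermediateField.adjoin ℝ (coord '' S), D₁ (toC r) = D₂ (toC r) := by
    intro r hr
    refine derivation_eqOn_adjoin (D₁ := D₁.compAlgebraMap JetRat)
      (D₂ := D₂.compAlgebraMap JetRat) ?_ hr
    rintro _ ⟨v, hv, rfl⟩
    exact h v hv
  rw [eq_re_add_im g]
  simp only [map_add, Derivation.leibniz, hi, key _ hre, key _ him]

theorem complex_derivation_ext {D₁ D₂ : Derivation ℝ CJetRat CJetRat}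
    (hi : D₁ imag = D₂ imag) (h : ∀ v, D₁ (toC (coord v)) = D₂ (toC (coord v))) : D₁ = D₂ := by
  apply Derivation.ext
  intro g
  apply complex_derivation_eqOn (S := Set.univ) hi fun v _ => h v
  all_goals
    rw [Set.image_univ, adjoin_coord_univ]
    trivial

/-- The complexified total derivative `D_x` in internal coordinates. -/
def cX : Derivation ℝ CJetRat CJetRat := complexify intX

/-- The complexified total derivative `D_y` in internal coordinates. -/
def cY : Derivation ℝ CJetRat CJetRat := complexify intY

theorem cX_cY (g : CJetRat) : cX (cY g) = cY (cX g) := complexify_comm intX_intY g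

/-- The function `1 / (4 (x + y))`. -/
def tau : CJetRat := toC (invSum / 4)

theorem tau_eq : 4 * tau = toC invSum := by
  rw [tau, ← map_ofNat toC 4, ← map_mul]
  congr 1
  field_simp

theorem derivation_tau {D : Derivation ℝ JetRat JetRat} (h : D invSum = -invSum ^ 2) :
    D (invSum / 4) = -4 * (invSum / 4) ^ 2 := by
  rw [Derivation.leibniz_div_const _ _ _ (by simpa using D.map_natCast 4), h, smul_eq_mul]
  ring

@[simp] theorem cX_tau : cX tau = -4 * tau ^ 2 := by
  rw [cX, tau, complexify_toC, derivation_tau intX_invSum]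
  simp [map_ofNat toC 4]

@[simp] theorem cY_tau : cY tau = -4 * tau ^ 2 := by
  rw [cY, tau, complexify_toC, derivation_tau intY_invSum]
  simp [map_ofNat toC 4]

@[simp] theorem cX_imag : cX imag = 0 := complexify_imag _
@[simp] theorem cY_imag : cY imag = 0 := complexify_imag _

/-- The factor is a nonzero element of the field `JetRat`, since odd integers do not vanish. This is
the cancellation behind every step along the ladder. -/
theorem eq_zero_of_odd_tau_mul {k : ℤ} {g : CJetRat} (h : (2 * (k : CJetRat) + 1) * tau * g = 0) :
    g = 0 := by
  have h1 : toC ((2 * (k : JetRat) + 1) * (invSum / 4)) * g = 0 := by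
    rw [map_mul, ← tau, ← h]
    simp [map_ofNat toC 2]
  have h2 : ((2 * (k : JetRat) + 1) * (invSum / 4)) ≠ 0 := by
    refine mul_ne_zero ?_ (div_ne_zero invSum_ne_zero (by norm_num))
    have : (2 * k + 1 : ℤ) ≠ 0 := by omega
    exact_mod_cast this
  rw [← Algebra.smul_def] at h1
  exact (smul_eq_zero.mp h1).resolve_left h2

/-! ### A basis of vertical forms adapted to the equation

In the characteristic coordinates `ζ, ζ̄` with `x + y = ζ + ζ̄` there are functions `T k`, `k : ℤ`,
linear in the jet variables, with `T 0 = u` and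
`2 (x + y) D_ζ (T k) = (2 k + 1) (T (k + 1) - T k)`,
`2 (x + y) D_ζ̄ (T k) = (2 k - 1) (T k - T (k - 1))`.
A linear form in them is represented by its coefficients `w : ℤ → CJetRat`. -/

/-- The operator on coefficients belonging to `D_ζ`. -/
def raiseOp (w : ℤ → CJetRat) (k : ℤ) : CJetRat := ((2 * k - 1 : ℤ) : CJetRat) * w (k - 1) - ((2 * k + 1 : ℤ) : CJetRat) * w k

/-- The operator on coefficients belonging to `D_ζ̄`. -/
def lowerOp (w : ℤ → CJetRat) (k : ℤ) : CJetRat := ((2 * k - 1 : ℤ) : CJetRat) * w k - ((2 * k + 1 : ℤ) : CJetRat) * w (k + 1)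

/-- The action of `D_x` on the coefficients of linear forms. -/
def formX (w : ℤ → CJetRat) (k : ℤ) : CJetRat :=
  cX (w k) + tau * ((1 - imag) * raiseOp w k + (1 + imag) * lowerOp w k)

/-- The action of `D_y` on the coefficients of linear forms. -/
def formY (w : ℤ → CJetRat) (k : ℤ) : CJetRat :=
  cY (w k) + tau * ((1 + imag) * raiseOp w k + (1 - imag) * lowerOp w k)

/-- Since `tau` has the same derivative `-4 tau ^ 2` in both directions, this amounts to the
relation `[R, L] = 2 (L - R)` between `R = raiseOp` and `L = lowerOp`. -/
theorem formX_formY (w : ℤ → CJetRat) : formX (formY w) = formY (formX w) := by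
  funext k
  simp only [formX, formY, raiseOp, lowerOp, map_add, map_sub, Derivation.leibniz, smul_eq_mul,
    cX_tau, cY_tau, cX_imag, cY_imag, Derivation.map_intCast, Derivation.map_one_eq_zero,
    sub_add_cancel, add_sub_cancel_right, cX_cY]
  push_cast
  ring

/-- The coefficients of `u`. -/
def formU (k : ℤ) : CJetRat := if k = 0 then 1 else 0

/-- The form `T 0` satisfies the equation solved for `u_xx`. The proof uses that `formU` is
supported at `0`, in the form `j * formU j = 0`. -/
theorem formX_formX_formU (k : ℤ) : formX (formX formU) k =
    -formY (formY formU) k - 4 * tau * (formX formU k + formY formU k) := by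
  have hc : ∀ (D : Derivation ℝ CJetRat CJetRat) (j : ℤ), D (formU j) = 0 := by
    intro D j
    rw [formU]
    split_ifs <;> simp
  have h0 : ∀ j : ℤ, (j : CJetRat) * formU j = 0 := by
    intro j
    rw [formU]
    split_ifs with h <;> simp [h]
  have h1 := h0 (k - 1)
  have h2 := h0 (k + 1)
  have h3 := h0 k
  have hi := imag_sq
  simp only [formX, formY, raiseOp, lowerOp, map_add, map_sub, Derivation.leibniz, smul_eq_mul,
    cX_tau, cY_tau, cX_imag, cY_imag, Derivation.map_intCast, Derivation.map_one_eq_zero,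
    sub_add_cancel, add_sub_cancel_right, hc, map_zero]
  push_cast at h1 h2 ⊢
  linear_combination (2 * tau ^ 2 *
    ((2 * k - 1) * ((2 * k - 3) * formU (k - 1 - 1) - (2 * k - 1) * formU (k - 1)) -
      (2 * k + 1) * ((2 * k - 1) * formU (k - 1) - (2 * k + 1) * formU k) +
      (2 * k - 1) * ((2 * k - 1) * formU k - (2 * k + 1) * formU (k + 1)) -
      (2 * k + 1) * ((2 * k + 1) * formU (k + 1) - (2 * k + 3) * formU (k + 1 + 1)) -
      4 * (2 * k - 1) * (k - 1) * formU (k - 1) - 4 * (2 * k + 1) * (k + 1) * formU (k + 1) +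
      16 * k ^ 2 * formU k)) * hi +
    4 * tau ^ 2 * (4 * (2 * k - 1) * h1 + 4 * (2 * k + 1) * h2 - 16 * k * h3)

/-- The coefficients of the jet coordinates. -/
def formCoeff : JetVar → ℤ → CJetRat
  | .x => 0
  | .y => 0
  | .u 0 j => formY^[j] formU
  | .u 1 j => formY^[j] (formX formU)
  | .u (_ + 2) _ => 0

theorem formX_zero : formX 0 = 0 := by
  funext k
  simp [formX, raiseOp, lowerOp]

theorem formY_zero : formY 0 = 0 := by
  funext k
  simp [formY, raiseOp, lowerOp]

theorem finite_support_shift {w : ℤ → CJetRat} (hw : {k | w k ≠ 0}.Finite) (c : ℤ) :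
    {k | w (k + c) ≠ 0}.Finite :=
  hw.preimage (f := (· + c)) (add_left_injective c).injOn

theorem finite_support_of_local {w w' : ℤ → CJetRat} (hw : {k | w k ≠ 0}.Finite)
    (h : ∀ k, w (k + -1) = 0 → w k = 0 → w (k + 1) = 0 → w' k = 0) : {k | w' k ≠ 0}.Finite := by
  refine (((finite_support_shift hw (-1)).union hw).union (finite_support_shift hw 1)).subset ?_
  intro k hk
  by_contra hn
  simp only [Set.mem_union, Set.mem_ofPred_eq, not_or, not_not] at hn
  exact hk (h k hn.1.1 hn.1.2 hn.2)

theorem formX_finite {w : ℤ → CJetRat} (hw : {k | w k ≠ 0}.Finite) : {k | formX w k ≠ 0}.Finite :=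
  finite_support_of_local hw fun k h1 h2 h3 => by
    simp [formX, raiseOp, lowerOp, sub_eq_add_neg, h1, h2, h3]

theorem formY_finite {w : ℤ → CJetRat} (hw : {k | w k ≠ 0}.Finite) : {k | formY w k ≠ 0}.Finite :=
  finite_support_of_local hw fun k h1 h2 h3 => by
    simp [formY, raiseOp, lowerOp, sub_eq_add_neg, h1, h2, h3]

theorem formY_iterate_finite {w : ℤ → CJetRat} (hw : {k | w k ≠ 0}.Finite) (j : ℕ) :
    {k | formY^[j] w k ≠ 0}.Finite := by
  induction j with
  | zero => exact hw
  | succ j ih => rw [Function.iterate_succ_apply']; exact formY_finite ih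

theorem formU_finite : {k | formU k ≠ 0}.Finite :=
  (Set.finite_singleton 0).subset fun k hk => by
    by_contra hn
    exact hk (if_neg hn)

theorem formCoeff_finite (v : JetVar) : {k | formCoeff v k ≠ 0}.Finite := by
  rcases v with _ | _ | ⟨_ | _ | h, j⟩
  · simp [formCoeff]
  · simp [formCoeff]
  · exact formY_iterate_finite formU_finite j
  · exact formY_iterate_finite (formX_finite formU_finite) j
  · simp [formCoeff]

/-! ### Derivations dual to the adapted forms -/

/-- The derivative with respect to the `k`-th adapted coordinate. -/
def adapted (k : ℤ) : Derivation ℝ CJetRat CJetRat := complexField fun v => formCoeff v k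

@[simp] theorem adapted_coord (k : ℤ) (v : JetVar) :
    adapted k (toC (coord v)) = formCoeff v k := complexField_coord _ _

@[simp] theorem adapted_imag (k : ℤ) : adapted k imag = 0 := complexField_imag _

theorem adapted_toC_finite (g : JetRat) : {k | adapted k (toC g) ≠ 0}.Finite :=
  finite_setOf_derivation_ne_zero (fun k => (adapted k).compAlgebraMap JetRat)
    (fun v => by simpa using formCoeff_finite v) g

theorem adapted_finite (g : CJetRat) : {k | adapted k g ≠ 0}.Finite := by
  refine ((adapted_toC_finite g.re).union (adapted_toC_finite g.im)).subset fun k hk => ?_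
  by_contra hn
  simp only [Set.mem_union, Set.mem_ofPred_eq, not_or, not_not] at hn
  apply hk
  rw [eq_re_add_im g, map_add, Derivation.leibniz, hn.1, hn.2, adapted_imag]
  simp

/-- The vertical differential commutes with `D_y`. Both sides of the commutator identity are
derivations, so it suffices to compare them on coordinates, where it is the recursion defining
`formCoeff`. -/
theorem adapted_cY (k : ℤ) (g : CJetRat) :
    adapted k (cY g) = formY (fun j => adapted j g) k := by
  have : ⁅adapted k, cY⁆ = tau • ((1 + imag) •
      (((2 * k - 1 : ℤ) : CJetRat) • adapted (k - 1) - ((2 * k + 1 : ℤ) : CJetRat) • adapted k) +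
      (1 - imag) •
      (((2 * k - 1 : ℤ) : CJetRat) • adapted k - ((2 * k + 1 : ℤ) : CJetRat) • adapted (k + 1))) := by
    apply complex_derivation_ext
    · simp [Derivation.commutator_apply]
    · intro v
      simp only [Derivation.commutator_apply, Derivation.add_apply, Derivation.sub_apply,
        Derivation.smul_apply, smul_eq_mul, adapted_coord, cY, complexify_toC]
      rw [← cY, sub_eq_iff_eq_add']
      change _ = formY (formCoeff v) k
      rcases v with _ | _ | ⟨_ | _ | h, j⟩
      · simp [formCoeff, formY_zero]
      · simp [formCoeff, formY_zero]
      · simp [formCoeff, -Function.iterate_succ, Function.iterate_succ_apply']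
      · simp [formCoeff, -Function.iterate_succ, Function.iterate_succ_apply']
      · simp [formCoeff, formY_zero]
  have h := congrArg (· g) this
  simp only [Derivation.commutator_apply, sub_eq_iff_eq_add'] at h
  exact h

theorem adapted_cY_iterate (n : ℕ) (g : CJetRat) :
    (fun k => adapted k (cY^[n] g)) = formY^[n] (fun k => adapted k g) := by
  induction n with
  | zero => rfl
  | succ n ih =>
    rw [Function.iterate_succ_apply', Function.iterate_succ_apply', ← ih]
    funext k
    exact adapted_cY k _

theorem toC_intY_iterate (n : ℕ) (g : JetRat) : toC (intY^[n] g) = cY^[n] (toC g) :=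
  Function.Semiconj.iterate_right (f := toC) (ga := intY) (gb := cY)
    (fun g => (complexify_toC intY g).symm) n g

theorem adapted_toC_invSum (k : ℤ) : adapted k (toC invSum) = 0 := by
  have h1 : (adapted k).compAlgebraMap JetRat invSum = 0 := by
    rw [invSum, Derivation.leibniz_inv]
    simp [formCoeff]
  exact h1

theorem adapted_tau (k : ℤ) : adapted k tau = 0 := by
  have h1 : (adapted k).compAlgebraMap JetRat (invSum / 4) = 0 := by
    rw [Derivation.leibniz_div_const _ _ _
      (by simpa using ((adapted k).compAlgebraMap JetRat).map_natCast 4)]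
    exact (congrArg _ (adapted_toC_invSum k)).trans (smul_zero _)
  exact h1

theorem adapted_intXX (k : ℤ) : adapted k (toC intXX) = formX (formX formU) k := by
  rw [formX_formX_formU, intXX, tau_eq]
  simp [adapted_toC_invSum, formCoeff]

/-- As for `D_y`, except that `D_x u_{x,jy}` is an iterated `D_y`-derivative of `u_xx`: here the
equation enters, through `adapted_intXX`. -/
theorem adapted_cX (k : ℤ) (g : CJetRat) :
    adapted k (cX g) = formX (fun j => adapted j g) k := by
  have : ⁅adapted k, cX⁆ = tau • ((1 - imag) •
      (((2 * k - 1 : ℤ) : CJetRat) • adapted (k - 1) - ((2 * k + 1 : ℤ) : CJetRat) • adapted k) +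
      (1 + imag) •
      (((2 * k - 1 : ℤ) : CJetRat) • adapted k - ((2 * k + 1 : ℤ) : CJetRat) • adapted (k + 1))) := by
    apply complex_derivation_ext
    · simp [Derivation.commutator_apply]
    · intro v
      simp only [Derivation.commutator_apply, Derivation.add_apply, Derivation.sub_apply,
        Derivation.smul_apply, smul_eq_mul, adapted_coord, cX, complexify_toC]
      rw [← cX, sub_eq_iff_eq_add']
      change _ = formX (formCoeff v) k
      have hcomm : ∀ j w, formX (formY^[j] w) = formY^[j] (formX w) := fun j w =>
        (Function.Commute.iterate_right (f := formX) (g := formY) formX_formY j) w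
      rcases v with _ | _ | ⟨_ | _ | h, j⟩
      · simp [formCoeff, formX_zero]
      · simp [formCoeff, formX_zero]
      · simp [formCoeff, hcomm]
      · simp only [zero_add, intX_w, toC_intY_iterate, formCoeff, hcomm]
        rw [← funext adapted_intXX, ← adapted_cY_iterate]
      · simp [formCoeff, formX_zero]
  have h := congrArg (· g) this
  simp only [Derivation.commutator_apply, sub_eq_iff_eq_add'] at h
  exact h

/-! ### Symmetries are affine in the adapted coordinates -/

/-- Twice the characteristic derivative `D_ζ`. -/
def cZ : Derivation ℝ CJetRat CJetRat := (1 + imag) • cX + (1 - imag) • cY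

/-- Twice the conjugate characteristic derivative. -/
def cZbar : Derivation ℝ CJetRat CJetRat := (1 - imag) • cX + (1 + imag) • cY

/-- In this combination the lowering parts cancel, as `(1 + i)² + (1 - i)² = 0`, while the raising
parts add up to `2 (1 + i)(1 - i) = 4`. -/
theorem adapted_cZ (k : ℤ) (g : CJetRat) :
    adapted k (cZ g) = cZ (adapted k g) + 4 * tau * raiseOp (fun j => adapted j g) k := by
  simp only [cZ, Derivation.add_apply, Derivation.smul_apply, smul_eq_mul, map_add, map_sub,
    Derivation.leibniz, adapted_imag, adapted_cX, adapted_cY, Derivation.map_one_eq_zero, formX,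
    formY]
  linear_combination (2 * tau * lowerOp (fun j => adapted j g) k -
    2 * tau * raiseOp (fun j => adapted j g) k) * imag_sq

theorem adapted_cZbar (k : ℤ) (g : CJetRat) :
    adapted k (cZbar g) = cZbar (adapted k g) + 4 * tau * lowerOp (fun j => adapted j g) k := by
  simp only [cZbar, Derivation.add_apply, Derivation.smul_apply, smul_eq_mul, map_add, map_sub,
    Derivation.leibniz, adapted_imag, adapted_cX, adapted_cY, Derivation.map_one_eq_zero, formX,
    formY]
  linear_combination (2 * tau * raiseOp (fun j => adapted j g) k -
    2 * tau * lowerOp (fun j => adapted j g) k) * imag_sq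

/-- The functions annihilated by all derivatives in the adapted coordinates. -/
def IsBasic (g : CJetRat) : Prop := ∀ k, adapted k g = 0

theorem IsBasic.add {g g' : CJetRat} (h : IsBasic g) (h' : IsBasic g') : IsBasic (g + g') :=
  fun k => by rw [map_add, h k, h' k, add_zero]

theorem IsBasic.sub {g g' : CJetRat} (h : IsBasic g) (h' : IsBasic g') : IsBasic (g - g') :=
  fun k => by rw [map_sub, h k, h' k, sub_zero]

theorem IsBasic.mul {g g' : CJetRat} (h : IsBasic g) (h' : IsBasic g') : IsBasic (g * g') :=
  fun k => by rw [Derivation.leibniz, h k, h' k, smul_zero, smul_zero, add_zero]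

theorem isBasic_tau : IsBasic tau := adapted_tau

theorem isBasic_intCast (n : ℤ) : IsBasic n := fun _ => Derivation.map_intCast _ n

theorem isBasic_four : IsBasic 4 := by simpa using isBasic_intCast 4

theorem IsBasic.cZ {g : CJetRat} (h : IsBasic g) : IsBasic (cZ g) := fun k => by
  simp [adapted_cZ, raiseOp, h _]

theorem IsBasic.cZbar {g : CJetRat} (h : IsBasic g) : IsBasic (cZbar g) := fun k => by
  simp [adapted_cZbar, lowerOp, h _]

theorem isBasic_of_odd_tau_mul {n : ℤ} {g : CJetRat}
    (h : IsBasic (((2 * n + 1 : ℤ) : CJetRat) * tau * g)) : IsBasic g := fun k => by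
  have h1 := h k
  rw [Derivation.leibniz, (isBasic_intCast _).mul isBasic_tau k, smul_zero, add_zero,
    smul_eq_mul] at h1
  push_cast at h1
  exact eq_zero_of_odd_tau_mul h1

theorem eq_zero_of_four_mul {g : CJetRat} (h : 4 * g = 0) : g = 0 := by
  have h1 : toC 4 * g = 0 := by rw [map_ofNat]; exact h
  rw [← Algebra.smul_def] at h1
  exact (smul_eq_zero.mp h1).resolve_left (by norm_num)

/-- There are no nontrivial integrals along the characteristics. -/
theorem isBasic_of_cZbar {g : CJetRat} (n : ℤ) (h : IsBasic (cZbar g + 4 * tau * (n * g))) :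
    IsBasic g := by
  by_contra hg
  simp only [IsBasic, not_forall] at hg
  have hfin := adapted_finite g
  -- At the index `m - 1`, just below the smallest `m` with a nonzero derivative, only the lowering
  -- term survives: it is `-4 tau (2 m - 1)` times `adapted m g`, with odd coefficient.
  obtain ⟨m, hm, hmin⟩ := hfin.exists_minimal hg
  have hbelow : adapted (m - 1) g = 0 := by
    by_contra hne
    have := hmin hne (by omega)
    omega
  have h1 := h (m - 1)
  simp only [map_add, Derivation.leibniz, adapted_cZbar, isBasic_tau _, isBasic_four _,
    isBasic_intCast n _, lowerOp, sub_add_cancel, hbelow, smul_eq_mul, mul_zero, map_zero,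
    zero_add, add_zero, zero_sub] at h1
  apply hm
  apply eq_zero_of_odd_tau_mul (k := m - 1)
  apply eq_zero_of_four_mul
  push_cast at h1 ⊢
  linear_combination -h1

/-- Take the largest `n` for which `adapted n g` is not basic and apply `adapted (n + 1)` to the
equation. The raising part of `D_ζ` brings in `adapted n g`; all else has index above `n` and is
basic. What remains is `4 (2 n + 1) tau` times `cZbar (adapted n g) + 4 tau (2 n) (adapted n g)`, to
which `isBasic_of_cZbar` applies. -/
theorem isBasic_adapted {g : CJetRat}
    (h : cZ (cZbar g) + 4 * tau * (cZ g + cZbar g) = 0) (k : ℤ) : IsBasic (adapted k g) := by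
  by_contra hk
  have hfin : {k | ¬ IsBasic (adapted k g)}.Finite :=
    (adapted_finite g).subset fun j hj h0 => hj fun l => by rw [h0, map_zero]
  obtain ⟨n, hn, hmax⟩ := hfin.exists_maximal ⟨k, hk⟩
  have habove : ∀ j, n < j → IsBasic (adapted j g) := by
    intro j hj
    by_contra hne
    have := hmax hne hj.le
    omega
  apply hn
  apply isBasic_of_cZbar (2 * n)
  have h1 : IsBasic (adapted (n + 1) (cZbar g)) := by
    rw [adapted_cZbar]
    exact (habove _ (by omega)).cZbar.add ((isBasic_four.mul isBasic_tau).mul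
      (((isBasic_intCast _).mul (habove _ (by omega))).sub
        ((isBasic_intCast _).mul (habove _ (by omega)))))
  have h2 := habove (n + 1) (by omega)
  have h3 := congrArg (adapted (n + 1)) h
  simp only [map_add, map_zero, Derivation.leibniz, isBasic_tau _, isBasic_four _, smul_eq_mul,
    mul_zero, add_zero, adapted_cZ, raiseOp, add_sub_cancel_right] at h3
  rw [adapted_cZbar n] at h3
  simp only [lowerOp] at h3
  have h4 : ((2 * n + 1 : ℤ) : CJetRat) * tau *
      (4 * (cZbar (adapted n g) + 4 * tau * ((2 * n : ℤ) * adapted n g))) =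
      ((2 * n + 1 : ℤ) * (2 * n + 1 : ℤ) * (4 * tau * (4 * tau)) +
        4 * tau * (4 * tau) * (2 * n + 3 : ℤ)) * adapted (n + 1) g +
      4 * tau * ((2 * n + 2 : ℤ) * adapted (n + 1) (cZbar g) - cZ (adapted (n + 1) g)) -
        cZ (adapted (n + 1) (cZbar g)) := by
    push_cast at h3 ⊢
    linear_combination h3
  have h5 : IsBasic (4 * tau) := isBasic_four.mul isBasic_tau
  have h6 : IsBasic (4 * (cZbar (adapted n g) + 4 * tau * ((2 * n : ℤ) * adapted n g))) := by
    apply isBasic_of_odd_tau_mul (n := n)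
    rw [h4]
    exact (((((isBasic_intCast _).mul (isBasic_intCast _)).mul (h5.mul h5)).add
      ((h5.mul h5).mul (isBasic_intCast _))).mul h2).add
      (h5.mul (((isBasic_intCast _).mul h1).sub h2.cZ)) |>.sub h1.cZ
  intro l
  have h7 := h6 l
  rw [Derivation.leibniz, isBasic_four, smul_zero, add_zero] at h7
  exact eq_zero_of_four_mul h7

/-! ### Basic functions do not depend on the jet variables -/

/-- The size of the extreme coefficients of a derivative of order `m`. -/
def lead : ℕ → CJetRat
  | 0 => 1
  | m + 1 => (2 * ((m : ℤ) : CJetRat) + 1) * tau * lead m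

theorem eq_zero_of_lead_mul {m : ℕ} {g : CJetRat} (h : lead m * g = 0) : g = 0 := by
  induction m with
  | zero => simpa [lead] using h
  | succ m ih => exact ih (eq_zero_of_odd_tau_mul (k := m) (by rw [← h, lead]; ring))

theorem eq_zero_of_one_add_imag_pow_mul {n : ℕ} {g : CJetRat} (h : (1 + imag) ^ n * g = 0) :
    g = 0 := by
  induction n with
  | zero => simpa using h
  | succ n ih =>
    apply ih
    apply eq_zero_of_four_mul
    linear_combination 2 * (1 - imag) * h + 2 * (1 + imag) ^ n * g * imag_sq

theorem eq_zero_of_one_sub_imag_pow_mul {n : ℕ} {g : CJetRat} (h : (1 - imag) ^ n * g = 0) :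
    g = 0 := by
  induction n with
  | zero => simpa using h
  | succ n ih =>
    apply ih
    apply eq_zero_of_four_mul
    linear_combination 2 * (1 + imag) * h + 2 * (1 - imag) ^ n * g * imag_sq

/-- The linear form `w` is supported in `[-m, m]` with extreme coefficients proportional to
`α` (at `m`) and `β` (at `-m`). -/
structure HasExtremes (m : ℕ) (α β : CJetRat) (w : ℤ → CJetRat) : Prop where
  above : ∀ k : ℤ, m < k → w k = 0
  below : ∀ k : ℤ, k < -m → w k = 0
  top : w m = lead m * α
  bottom : w (-m) = lead m * β

theorem hasExtremes_formU : HasExtremes 0 1 1 formU where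
  above k hk := if_neg (by simp at hk; omega)
  below k hk := if_neg (by simp at hk; omega)
  top := by simp [formU, lead]
  bottom := by simp [formU, lead]

/-- At the new top `m + 1` only raising contributes, at the new bottom only lowering, both with
factor `2 m + 1`. The derivative of the coefficient contributes nothing there because `w` vanishes
outside `[-m, m]`. -/
theorem HasExtremes.map_formY {m : ℕ} {α β : CJetRat} {w : ℤ → CJetRat} (h : HasExtremes m α β w) :
    HasExtremes (m + 1) ((1 + imag) * α) ((1 - imag) * β) (formY w) where
  above k hk := by
    push_cast at hk
    simp [formY, raiseOp, lowerOp, h.above k (by omega), h.above (k - 1) (by omega),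
      h.above (k + 1) (by omega)]
  below k hk := by
    push_cast at hk
    simp [formY, raiseOp, lowerOp, h.below k (by omega), h.below (k - 1) (by omega),
      h.below (k + 1) (by omega)]
  top := by
    simp only [formY, raiseOp, lowerOp]
    push_cast
    rw [add_sub_cancel_right, h.top, h.above (m + 1) (by omega), h.above (m + 1 + 1) (by omega), lead]
    push_cast
    simp
    ring
  bottom := by
    simp only [formY, raiseOp, lowerOp]
    push_cast
    rw [show -((m : ℤ) + 1) + 1 = -m by ring, h.bottom, h.below (-(m + 1)) (by omega),
      h.below (-(m + 1) - 1) (by omega), lead]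
    push_cast
    simp
    ring

theorem HasExtremes.map_formX {m : ℕ} {α β : CJetRat} {w : ℤ → CJetRat} (h : HasExtremes m α β w) :
    HasExtremes (m + 1) ((1 - imag) * α) ((1 + imag) * β) (formX w) where
  above k hk := by
    push_cast at hk
    simp [formX, raiseOp, lowerOp, h.above k (by omega), h.above (k - 1) (by omega),
      h.above (k + 1) (by omega)]
  below k hk := by
    push_cast at hk
    simp [formX, raiseOp, lowerOp, h.below k (by omega), h.below (k - 1) (by omega),
      h.below (k + 1) (by omega)]
  top := by
    simp only [formX, raiseOp, lowerOp]
    push_cast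
    rw [add_sub_cancel_right, h.top, h.above (m + 1) (by omega), h.above (m + 1 + 1) (by omega), lead]
    push_cast
    simp
    ring
  bottom := by
    simp only [formX, raiseOp, lowerOp]
    push_cast
    rw [show -((m : ℤ) + 1) + 1 = -m by ring, h.bottom, h.below (-(m + 1)) (by omega),
      h.below (-(m + 1) - 1) (by omega), lead]
    push_cast
    simp
    ring

theorem HasExtremes.map_formY_iterate {m : ℕ} {α β : CJetRat} {w : ℤ → CJetRat}
    (h : HasExtremes m α β w) (j : ℕ) :
    HasExtremes (m + j) ((1 + imag) ^ j * α) ((1 - imag) ^ j * β) (formY^[j] w) := by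
  induction j with
  | zero => simpa using h
  | succ j ih =>
    rw [Function.iterate_succ_apply', pow_succ', pow_succ', mul_assoc, mul_assoc]
    exact ih.map_formY

theorem hasExtremes_v (j : ℕ) :
    HasExtremes j ((1 + imag) ^ j) ((1 - imag) ^ j) (formCoeff (.u 0 j)) := by
  simpa [formCoeff] using hasExtremes_formU.map_formY_iterate j

theorem hasExtremes_w (j : ℕ) : HasExtremes (j + 1) ((1 + imag) ^ j * (1 - imag))
    ((1 - imag) ^ j * (1 + imag)) (formCoeff (.u 1 j)) := by
  simpa [formCoeff, add_comm] using hasExtremes_formU.map_formX.map_formY_iterate j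

/-! ### Comparison of the adapted derivations with the jet coordinates -/

/-- The partial derivative on complex rational functions. -/
def cPartial (a : JetVar) : Derivation ℝ CJetRat CJetRat := complexify (partialDeriv a)

theorem cPartial_self (a : JetVar) : cPartial a (toC (coord a)) = 1 := by
  rw [cPartial, complexify_toC, partialDeriv_self, map_one]

theorem cPartial_of_ne {a v : JetVar} (h : v ≠ a) : cPartial a (toC (coord v)) = 0 := by
  rw [cPartial, complexify_toC, partialDeriv_of_ne h, map_zero]

@[simp] theorem cPartial_imag (a : JetVar) : cPartial a imag = 0 := complexify_imag _

theorem cPartial_tau (h j : ℕ) : cPartial (.u h j) tau = 0 := by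
  rw [cPartial, tau, complexify_toC, Derivation.leibniz_div_const _ _ _
    (by simpa using (partialDeriv (.u h j)).map_natCast 4), invSum, Derivation.leibniz_inv, map_add,
    partialDeriv_of_ne (by simp), partialDeriv_of_ne (by simp)]
  simp

/-- The functions of `x + y` generated by the imaginary unit and `tau`. -/
def coeffAlgebra : Subalgebra ℝ CJetRat := Algebra.adjoin ℝ {imag, tau}

theorem imag_mem : imag ∈ coeffAlgebra := Algebra.subset_adjoin (by simp)

theorem tau_mem : tau ∈ coeffAlgebra := Algebra.subset_adjoin (by simp)

theorem derivation_mem_coeffAlgebra {D : Derivation ℝ CJetRat CJetRat} (hi : D imag = 0)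
    (ht : D tau ∈ coeffAlgebra) {g : CJetRat} (hg : g ∈ coeffAlgebra) : D g ∈ coeffAlgebra := by
  induction hg using Algebra.adjoin_induction with
  | mem x hx =>
    obtain rfl | rfl := hx
    · rw [hi]
      exact zero_mem _
    · exact ht
  | algebraMap r => rw [Derivation.map_algebraMap]; exact zero_mem _
  | add x y _ _ hx hy => rw [map_add]; exact add_mem hx hy
  | mul x y hx' hy' hx hy =>
    rw [Derivation.leibniz]
    exact add_mem (mul_mem hx' hy) (mul_mem hy' hx)

theorem neg_four_tau_sq_mem : -4 * tau ^ 2 ∈ coeffAlgebra :=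
  mul_mem (neg_mem (by simp)) (pow_mem tau_mem 2)

theorem raiseOp_mem {w : ℤ → CJetRat} (hw : ∀ k, w k ∈ coeffAlgebra) (k : ℤ) :
    raiseOp w k ∈ coeffAlgebra :=
  sub_mem (mul_mem (intCast_mem _ _) (hw _)) (mul_mem (intCast_mem _ _) (hw _))

theorem lowerOp_mem {w : ℤ → CJetRat} (hw : ∀ k, w k ∈ coeffAlgebra) (k : ℤ) :
    lowerOp w k ∈ coeffAlgebra :=
  sub_mem (mul_mem (intCast_mem _ _) (hw _)) (mul_mem (intCast_mem _ _) (hw _))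

theorem formX_mem {w : ℤ → CJetRat} (hw : ∀ k, w k ∈ coeffAlgebra) (k : ℤ) :
    formX w k ∈ coeffAlgebra :=
  add_mem (derivation_mem_coeffAlgebra cX_imag (cX_tau ▸ neg_four_tau_sq_mem) (hw k))
    (mul_mem tau_mem (add_mem (mul_mem (sub_mem (one_mem _) imag_mem) (raiseOp_mem hw k))
      (mul_mem (add_mem (one_mem _) imag_mem) (lowerOp_mem hw k))))

theorem formY_mem {w : ℤ → CJetRat} (hw : ∀ k, w k ∈ coeffAlgebra) (k : ℤ) :
    formY w k ∈ coeffAlgebra :=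
  add_mem (derivation_mem_coeffAlgebra cY_imag (cY_tau ▸ neg_four_tau_sq_mem) (hw k))
    (mul_mem tau_mem (add_mem (mul_mem (add_mem (one_mem _) imag_mem) (raiseOp_mem hw k))
      (mul_mem (sub_mem (one_mem _) imag_mem) (lowerOp_mem hw k))))

theorem formY_iterate_mem {w : ℤ → CJetRat} (hw : ∀ k, w k ∈ coeffAlgebra) (j : ℕ) (k : ℤ) :
    formY^[j] w k ∈ coeffAlgebra := by
  induction j generalizing k with
  | zero => exact hw k
  | succ j ih => rw [Function.iterate_succ_apply']; exact formY_mem ih k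

theorem formU_mem (k : ℤ) : formU k ∈ coeffAlgebra := by
  rw [formU]
  split_ifs
  exacts [one_mem _, zero_mem _]

theorem formCoeff_mem (v : JetVar) (k : ℤ) : formCoeff v k ∈ coeffAlgebra := by
  rcases v with _ | _ | ⟨_ | _ | h, j⟩
  · exact zero_mem _
  · exact zero_mem _
  · exact formY_iterate_mem formU_mem j k
  · exact formY_iterate_mem (formX_mem formU_mem) j k
  · exact zero_mem _

theorem cPartial_coeffAlgebra (h j : ℕ) {g : CJetRat} (hg : g ∈ coeffAlgebra) :
    cPartial (.u h j) g = 0 := by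
  refine Derivation.eqOn_adjoin (D2 := 0) ?_ hg
  rintro x (rfl | rfl)
  · simp
  · simp [cPartial_tau]

/-- The coefficients of `adapted k` lie in `coeffAlgebra`, so they are constant in the jet
variables. -/
theorem adapted_cPartial (k : ℤ) (h j : ℕ) (g : CJetRat) :
    adapted k (cPartial (.u h j) g) = cPartial (.u h j) (adapted k g) := by
  have : ⁅adapted k, cPartial (.u h j)⁆ = 0 := by
    apply complex_derivation_ext
    · simp [Derivation.commutator_apply]
    · intro v
      rw [Derivation.commutator_apply, adapted_coord, cPartial_coeffAlgebra h j (formCoeff_mem v k)]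
      by_cases hv : v = .u h j
      · simp [hv, cPartial_self]
      · simp [cPartial_of_ne hv]
  have h := congrArg (· g) this
  simpa only [Derivation.commutator_apply, Derivation.zero_apply, sub_eq_zero] using h

/-- `g` does not involve `u_{jy}` for `j > J` and `u_{x,jy}` for `j ≥ J`. -/
def OrderLE (J : ℕ) (g : CJetRat) : Prop :=
  (∀ j, J < j → cPartial (.u 0 j) g = 0) ∧ ∀ j, J ≤ j → cPartial (.u 1 j) g = 0

/-- The jet coordinates other than `u_{jy}` for `j > J` and `u_{x,jy}` for `j ≥ J`. -/
def lowVars (J : ℕ) : Set JetVar := {v | ∀ j, (J < j → v ≠ .u 0 j) ∧ (J ≤ j → v ≠ .u 1 j)}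

theorem OrderLE.derivation_eq {J : ℕ} {g : CJetRat} (hg : OrderLE J g)
    {D₁ D₂ : Derivation ℝ CJetRat CJetRat} (hi : D₁ imag = D₂ imag)
    (h : ∀ v ∈ lowVars J, D₁ (toC (coord v)) = D₂ (toC (coord v))) : D₁ g = D₂ g := by
  have key : ∀ a ∉ lowVars J, cPartial a g = 0 := by
    intro a ha
    simp only [lowVars, Set.mem_ofPred_eq, not_forall, not_and_or, not_not] at ha
    obtain ⟨j, ⟨hj, rfl⟩ | ⟨hj, rfl⟩⟩ := ha
    · exact hg.1 j hj
    · exact hg.2 j hj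
  exact complex_derivation_eqOn hi h
    (mem_adjoin_of_partialDeriv_eq_zero fun a ha => (complexify_eq_zero_iff.mp (key a ha)).1)
    (mem_adjoin_of_partialDeriv_eq_zero fun a ha => (complexify_eq_zero_iff.mp (key a ha)).2)

theorem exists_orderLE (g : CJetRat) : ∃ J, OrderLE J g := by
  obtain ⟨N, hN⟩ := exists_order g.re
  obtain ⟨M, hM⟩ := exists_order g.im
  refine ⟨N + M, fun j hj => ?_, fun j hj => ?_⟩
  · exact complexify_eq_zero_iff.mpr ⟨(hN j (by omega)).1, (hM j (by omega)).1⟩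
  · exact complexify_eq_zero_iff.mpr ⟨(hN j (by omega)).2, (hM j (by omega)).2⟩

theorem adapted_eq_of_orderLE {n : ℕ} {g : CJetRat} (hg : OrderLE (n + 1) g) {k : ℤ}
    (hv : ∀ j ≤ n, formCoeff (.u 0 j) k = 0) (hw : ∀ j < n, formCoeff (.u 1 j) k = 0) :
    adapted k g = formCoeff (.u 0 (n + 1)) k * cPartial (.u 0 (n + 1)) g +
      formCoeff (.u 1 n) k * cPartial (.u 1 n) g := by
  refine hg.derivation_eq (D₁ := adapted k) (D₂ := formCoeff (.u 0 (n + 1)) k •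
    cPartial (.u 0 (n + 1)) + formCoeff (.u 1 n) k • cPartial (.u 1 n)) (by simp) ?_
  intro v hvl
  simp only [adapted_coord, Derivation.add_apply, Derivation.smul_apply, smul_eq_mul]
  by_cases h0 : v = .u 0 (n + 1)
  · subst h0
    rw [cPartial_self, cPartial_of_ne (by simp), mul_one, mul_zero, add_zero]
  by_cases h1 : v = .u 1 n
  · subst h1
    rw [cPartial_self, cPartial_of_ne (by simp), mul_one, mul_zero, zero_add]
  rw [cPartial_of_ne h0, cPartial_of_ne h1, mul_zero, mul_zero, add_zero]
  rcases v with _ | _ | ⟨_ | _ | h, j⟩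
  · rfl
  · rfl
  · apply hv
    by_contra hj
    have : j ≠ n + 1 := fun h => h0 (by rw [h])
    exact (hvl j).1 (by omega) rfl
  · apply hw
    by_contra hj
    have : j ≠ n := fun h => h1 (by rw [h])
    exact (hvl j).2 (by omega) rfl
  · rfl

/-- At the indices `±(n + 1)` only `u_{(n+1)y}` and `u_{x,ny}` contribute. The two resulting linear
equations have, up to cancellable factors, determinant `(1 + i)² - (1 - i)² = 4 i`. -/
theorem IsBasic.orderLE_pred {n : ℕ} {g : CJetRat} (hb : IsBasic g) (hg : OrderLE (n + 1) g) :
    cPartial (.u 0 (n + 1)) g = 0 ∧ cPartial (.u 1 n) g = 0 := by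
  have htop := adapted_eq_of_orderLE hg (k := ((n + 1 : ℕ) : ℤ))
    (fun j hj => (hasExtremes_v j).above _ (by push_cast; omega))
    (fun j hj => (hasExtremes_w j).above _ (by push_cast; omega))
  have hbot := adapted_eq_of_orderLE hg (k := -((n + 1 : ℕ) : ℤ))
    (fun j hj => (hasExtremes_v j).below _ (by push_cast; omega))
    (fun j hj => (hasExtremes_w j).below _ (by push_cast; omega))
  rw [hb, (hasExtremes_v _).top, (hasExtremes_w _).top] at htop
  rw [hb, (hasExtremes_v _).bottom, (hasExtremes_w _).bottom] at hbot
  set p := cPartial (.u 0 (n + 1)) g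
  set q := cPartial (.u 1 n) g
  have h1 : (1 + imag) * p + (1 - imag) * q = 0 := by
    apply eq_zero_of_one_add_imag_pow_mul (n := n)
    apply eq_zero_of_lead_mul (m := n + 1)
    linear_combination -htop
  have h2 : (1 - imag) * p + (1 + imag) * q = 0 := by
    apply eq_zero_of_one_sub_imag_pow_mul (n := n)
    apply eq_zero_of_lead_mul (m := n + 1)
    linear_combination -hbot
  constructor
  · apply eq_zero_of_four_mul
    linear_combination -imag * ((1 + imag) * h1 - (1 - imag) * h2) + 4 * p * imag_sq
  · apply eq_zero_of_four_mul
    linear_combination -imag * ((1 + imag) * h2 - (1 - imag) * h1) + 4 * q * imag_sq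

/-- Descent on the order: `orderLE_pred` removes the two top variables at each step, until only `u`
is left, on which `adapted 0` acts as `∂/∂u`. -/
theorem IsBasic.cPartial_eq_zero {g : CJetRat} (hb : IsBasic g) (j : ℕ) :
    cPartial (.u 0 j) g = 0 ∧ cPartial (.u 1 j) g = 0 := by
  obtain ⟨J, hJ⟩ := exists_orderLE g
  induction J with
  | zero =>
    have h0 := hJ.derivation_eq (D₁ := adapted 0) (D₂ := cPartial (.u 0 0)) (by simp) (by
      intro v hv
      rw [adapted_coord]
      rcases v with _ | _ | ⟨_ | _ | h, j⟩
      · exact (cPartial_of_ne (by simp)).symm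
      · exact (cPartial_of_ne (by simp)).symm
      · obtain rfl : j = 0 := by
          by_contra hj
          exact (hv j).1 (by omega) rfl
        rw [cPartial_self]
        simp [formCoeff, formU]
      · exact absurd rfl ((hv j).2 (by omega))
      · exact (cPartial_of_ne (by simp)).symm)
    refine ⟨?_, hJ.2 j (Nat.zero_le j)⟩
    obtain rfl | hj := Nat.eq_zero_or_pos j
    · rw [← h0, hb]
    · exact hJ.1 j hj
  | succ n ih =>
    have h := hb.orderLE_pred hJ
    refine ih ⟨fun i hi => ?_, fun i hi => ?_⟩
    · obtain rfl | hne := eq_or_ne i (n + 1)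
      · exact h.1
      · exact hJ.1 i (by omega)
    · obtain rfl | hne := eq_or_ne i n
      · exact h.2
      · exact hJ.2 i (by omega)

/-- The jet variables among the internal coordinates. -/
def IsInternal (a : JetVar) : Prop := ∃ j, a = .u 0 j ∨ a = .u 1 j

theorem IsBasic.cPartial_internal {g : CJetRat} (hb : IsBasic g) {a : JetVar} (ha : IsInternal a) :
    cPartial a g = 0 := by
  obtain ⟨j, rfl | rfl⟩ := ha
  exacts [(hb.cPartial_eq_zero j).1, (hb.cPartial_eq_zero j).2]

/-- The second derivatives of a symmetry in the internal jet variables vanish. -/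
theorem partialDeriv_partialDeriv_eq_zero {g : JetRat}
    (hg : (coord .x + coord .y) * (intX (intX g) + intY (intY g)) + intX g + intY g = 0)
    {a b : JetVar} (ha : IsInternal a) (hb : IsInternal b) :
    partialDeriv a (partialDeriv b g) = 0 := by
  have h1 : intX (intX g) + intY (intY g) + invSum * (intX g + intY g) = 0 := by
    linear_combination invSum * hg - (intX (intX g) + intY (intY g)) * sum_mul_invSum
  have h2 := congrArg toC h1
  simp only [map_add, map_mul, map_zero, ← tau_eq, ← complexify_toC] at h2
  rw [← cX, ← cY] at h2
  -- Here `cZ ∘ cZbar = 2 (cX² + cY²)` and `cZ + cZbar = 2 (cX + cY)`, so this is twice the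
  -- equation.
  have h3 : cZ (cZbar (toC g)) + 4 * tau * (cZ (toC g) + cZbar (toC g)) = 0 := by
    simp only [cZ, cZbar, Derivation.add_apply, Derivation.smul_apply, smul_eq_mul, map_add,
      map_sub, Derivation.leibniz, cX_imag, cY_imag, Derivation.map_one_eq_zero, cX_cY]
    linear_combination 2 * h2 + (2 * cY (cX (toC g)) - cX (cX (toC g)) - cY (cY (toC g))) * imag_sq
  have h4 := isBasic_adapted h3
  -- Basicness is used twice: `∂_b` kills the basic function `adapted k g` and commutes with
  -- `adapted k`, so `∂_b g` is basic, and then `∂_a` kills it.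
  have h5 : IsBasic (cPartial b (toC g)) := by
    intro k
    have h6 := (h4 k).cPartial_internal hb
    obtain ⟨j, rfl | rfl⟩ := hb <;> rw [adapted_cPartial, h6]
  have h7 := h5.cPartial_internal ha
  rw [cPartial, cPartial, complexify_toC, complexify_toC] at h7
  exact (map_eq_zero_iff toC QuadraticAlgebra.algebraMap_injective).mp h7

/-! ### Affine dependence on the jet variables -/

theorem comm_iterate_of_comm {D D' : Derivation ℝ JetRat JetRat}
    (h : ∀ g, D (D' g) = D' (D g)) (n : ℕ) (g : JetRat) : D (D'^[n] g) = D'^[n] (D g) :=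
  (Function.Commute.iterate_right (f := D) (g := D') h n) g

/-- The internal total derivatives do not involve `u_{hx,ky}` with `h ≥ 2`. Together with the
analogue for `intX`, this shows that restrictions do not depend on these variables. -/
theorem partialDeriv_high_intY (h j : ℕ) (g : JetRat) :
    partialDeriv (.u (h + 2) j) (intY g) = intY (partialDeriv (.u (h + 2) j) g) := by
  apply derivation_comm_of_coord
  intro v
  by_cases hv : v = .u (h + 2) j
  · simp [hv, partialDeriv_self]
  rw [partialDeriv_of_ne hv, map_zero]
  rcases v with _ | _ | ⟨_ | _ | i, k⟩ <;> simp [partialDeriv_of_ne]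

theorem derivation_invSum {D : Derivation ℝ JetRat JetRat} (hx : D (coord .x) = 0)
    (hy : D (coord .y) = 0) : D invSum = 0 := by
  rw [invSum, Derivation.leibniz_inv, map_add, hx, hy, add_zero, smul_zero]

theorem partialDeriv_high_intX (h j : ℕ) (g : JetRat) :
    partialDeriv (.u (h + 2) j) (intX g) = intX (partialDeriv (.u (h + 2) j) g) := by
  apply derivation_comm_of_coord
  intro v
  by_cases hv : v = .u (h + 2) j
  · simp [hv, partialDeriv_self]
  rw [partialDeriv_of_ne hv, map_zero]
  rcases v with _ | _ | ⟨_ | _ | i, k⟩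
  · simp
  · simp
  · simp [partialDeriv_of_ne]
  · rw [zero_add, intX_w, comm_iterate_of_comm (partialDeriv_high_intY h j)]
    simp [intXX, partialDeriv_of_ne,
      derivation_invSum (D := partialDeriv (.u (h + 2) j)) (partialDeriv_of_ne (by simp))
        (partialDeriv_of_ne (by simp))]
  · simp

theorem restrict_u (h k : ℕ) :
    restrict (MvPolynomial.X (.u h k)) = intX^[h] (coord (.u 0 k)) := by
  rw [restrict, AlgHom.comp_apply, toLoc_u,
    Function.Semiconj.iterate_right (f := locToRat) (ga := locX) (gb := intX) locToRat_locX h,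
    locToRat_loc]

theorem partialDeriv_high_restrict (h j : ℕ) (p : JetPoly) :
    partialDeriv (.u (h + 2) j) (restrict p) = 0 := by
  induction p using MvPolynomial.induction_on with
  | C a => rw [← MvPolynomial.algebraMap_eq, AlgHom.commutes, Derivation.map_algebraMap]
  | add p q hp hq => rw [map_add, map_add, hp, hq, add_zero]
  | mul_X p i hp =>
    rw [map_mul, Derivation.leibniz, hp, smul_zero, add_zero]
    convert! smul_zero _
    rcases i with _ | _ | ⟨i, k⟩
    · simp [restrict, partialDeriv_of_ne]
    · simp [restrict, partialDeriv_of_ne]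
    · rw [restrict_u, comm_iterate_of_comm (partialDeriv_high_intX h j), partialDeriv_of_ne (by simp),
        iterate_map_zero]

theorem HasRestriction.partialDeriv_high {r g : JetRat} (hg : HasRestriction r g) (h j : ℕ) :
    partialDeriv (.u (h + 2) j) g = 0 := by
  obtain ⟨p, q, -, -, rfl⟩ := hg
  rw [Derivation.leibniz_div, partialDeriv_high_restrict, partialDeriv_high_restrict]
  simp

theorem mem_baseField_of_partialDeriv {g : JetRat} (h : ∀ i j, partialDeriv (.u i j) g = 0) :
    g ∈ baseField := by
  rw [baseField, ← Set.image_pair]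
  apply mem_adjoin_of_partialDeriv_eq_zero
  rintro (_ | _ | ⟨i, j⟩) ha
  · simp at ha
  · simp at ha
  · exact h i j

theorem derivation_baseField {D D' : Derivation ℝ JetRat JetRat}
    (hx : D (coord .x) = D' (coord .x)) (hy : D (coord .y) = D' (coord .y)) {g : JetRat}
    (hg : g ∈ baseField) : D g = D' g := by
  refine derivation_eqOn_adjoin (D₁ := D) (D₂ := D') ?_ hg
  rintro _ (rfl | rfl)
  exacts [hx, hy]

theorem derivation_mem_baseField {D : Derivation ℝ JetRat JetRat}
    (hx : D (coord .x) ∈ baseField) (hy : D (coord .y) ∈ baseField) {g : JetRat}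
    (hg : g ∈ baseField) : D g ∈ baseField := by
  induction hg using IntermediateField.adjoin_induction with
  | mem x hx' =>
    obtain rfl | rfl := hx'
    exacts [hx, hy]
  | algebraMap r => rw [Derivation.map_algebraMap]; exact zero_mem _
  | add x y _ _ h1 h2 => rw [map_add]; exact add_mem h1 h2
  | inv x h h1 =>
    rw [Derivation.leibniz_inv]
    exact mul_mem (neg_mem (pow_mem (inv_mem h) 2)) h1
  | mul x y h h' h1 h2 =>
    rw [Derivation.leibniz]
    exact add_mem (mul_mem h h2) (mul_mem h' h1)

theorem isRationalSolution_of_internal {f : JetRat} (hf : f ∈ baseField)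
    (h : (coord .x + coord .y) * (intX (intX f) + intY (intY f)) + intX f + intY f = 0) :
    IsRationalSolution f := by
  have hX : ∀ g ∈ baseField, partialX g = intX g := fun g hg =>
    derivation_baseField (by rw [partialX, vectorField_coord, intX_x])
      (by rw [partialX, vectorField_coord, intX_y]) hg
  have hY : ∀ g ∈ baseField, partialY g = intY g := fun g hg =>
    derivation_baseField (by rw [partialY, vectorField_coord, intY_x])
      (by rw [partialY, vectorField_coord, intY_y]) hg
  refine ⟨hf, ?_⟩
  rw [hX f hf, hY f hf, hX (intX f) (derivation_mem_baseField (by simp) (by simp) hf),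
    hY (intY f) (derivation_mem_baseField (by simp) (by simp) hf), h]

/-! ### Separating the linear part with the scaling field -/

/-- The infinitesimal scaling of the jet variables. -/
def scaling : Derivation ℝ JetRat JetRat :=
  vectorField fun v => match v with
    | .x => 0
    | .y => 0
    | .u h k => coord (.u h k)

@[simp] theorem scaling_x : scaling (coord .x) = 0 := vectorField_coord _ _
@[simp] theorem scaling_y : scaling (coord .y) = 0 := vectorField_coord _ _
@[simp] theorem scaling_u (h k : ℕ) : scaling (coord (.u h k)) = coord (.u h k) :=
  vectorField_coord _ _

theorem scaling_intY (g : JetRat) : scaling (intY g) = intY (scaling g) := by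
  apply derivation_comm_of_coord
  rintro (_ | _ | ⟨_ | _ | h, j⟩) <;> simp

theorem scaling_intXX : scaling intXX = intXX := by
  simp [intXX, derivation_invSum scaling_x scaling_y]

theorem scaling_intX (g : JetRat) : scaling (intX g) = intX (scaling g) := by
  apply derivation_comm_of_coord
  rintro (_ | _ | ⟨_ | _ | h, j⟩) <;> simp [comm_iterate_of_comm scaling_intY, scaling_intXX]

theorem scaling_baseField {g : JetRat} (hg : g ∈ baseField) : scaling g = 0 :=
  derivation_baseField (D' := 0) (by simp) (by simp) hg

theorem HasRestriction.sum {s : Finset ℕ} {r g : ℕ → JetRat}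
    (h : ∀ k, HasRestriction (r k) (g k)) : HasRestriction (∑ k ∈ s, r k) (∑ k ∈ s, g k) := by
  classical
  induction s using Finset.induction_on with
  | empty => simpa using hasRestriction_algebraMap 0
  | insert a s ha ih =>
    rw [Finset.sum_insert ha, Finset.sum_insert ha]
    exact (h a).add ih

end EulerDarboux

end

/-! ### The theorem -/

open EulerDarboux in
theorem mainTheorem5 (φ : EulerDarboux.JetRat) (hφ : EulerDarboux.IsRationalSymmetry φ) :
    ∃ (f : EulerDarboux.JetRat) (N : ℕ) (a b : ℕ → EulerDarboux.JetRat),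
      EulerDarboux.IsRationalSolution f ∧
      (∀ k, a k ∈ EulerDarboux.baseField) ∧
      (∀ k, b k ∈ EulerDarboux.baseField) ∧
      EulerDarboux.VanishesOnProlongation
        (φ - (f + ∑ k ∈ Finset.range N, a k * EulerDarboux.coord (.u 1 k) +
          ∑ k ∈ Finset.range N, b k * EulerDarboux.coord (.u 0 k))) := by
  obtain ⟨g, hg⟩ := hφ.1.hasRestriction
  have hL := hφ.linearized hg
  obtain ⟨N, hN⟩ := exists_order g
  -- The coefficients of the linear part are the first jet derivatives of `g`; they are base
  -- functions because the second ones vanish.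
  have hmem : ∀ b, IsInternal b → partialDeriv b g ∈ baseField := by
    intro b hb
    apply mem_baseField_of_partialDeriv
    rintro (_ | _ | i) j
    · exact partialDeriv_partialDeriv_eq_zero hL ⟨j, .inl rfl⟩ hb
    · exact partialDeriv_partialDeriv_eq_zero hL ⟨j, .inr rfl⟩ hb
    · rw [partialDeriv_comm, hg.partialDeriv_high, map_zero]
  have ha : ∀ k, partialDeriv (.u 1 k) g ∈ baseField := fun k => hmem _ ⟨k, .inr rfl⟩
  have hb : ∀ k, partialDeriv (.u 0 k) g ∈ baseField := fun k => hmem _ ⟨k, .inl rfl⟩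
  set lin := ∑ k ∈ Finset.range N, partialDeriv (.u 1 k) g * coord (.u 1 k) +
    ∑ k ∈ Finset.range N, partialDeriv (.u 0 k) g * coord (.u 0 k) with hlin
  have hzero : ∀ i j r, r ∈ baseField → partialDeriv (.u i j) r = 0 := fun i j r hr =>
    derivation_baseField (D' := 0) (partialDeriv_of_ne (by simp)) (partialDeriv_of_ne (by simp)) hr
  have hf : g - lin ∈ baseField := by
    apply mem_baseField_of_partialDeriv
    intro i j
    have hpart : ∀ c : ℕ → JetRat, (∀ k, c k ∈ baseField) → (∀ k, N ≤ k → c k = 0) → ∀ h,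
        partialDeriv (.u i j) (∑ k ∈ Finset.range N, c k * coord (.u h k)) =
          if i = h then c j else 0 := by
      intro c hc hcN h
      rw [map_sum]
      simp only [Derivation.leibniz, hzero i j _ (hc _), smul_eq_mul, mul_zero, add_zero]
      split_ifs with hi
      · subst hi
        rw [Finset.sum_eq_single j]
        · rw [partialDeriv_self, mul_one]
        · intro k _ hk
          rw [partialDeriv_of_ne (by simpa using hk), mul_zero]
        · intro hj
          rw [hcN j (by simpa using hj), zero_mul]
      · exact Finset.sum_eq_zero fun k _ => by
          rw [partialDeriv_of_ne (by simp [Ne.symm hi]), mul_zero]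
    rw [map_sub, hlin, map_add, hpart _ ha fun k hk => (hN k hk).2,
      hpart _ hb fun k hk => (hN k hk).1]
    obtain _ | _ | i := i
    · simp
    · simp
    · simp [hg.partialDeriv_high]
  -- Scaling kills the base function `g - lin` and fixes `lin`, which is homogeneous of degree one.
  have hscale : scaling g = lin := by
    have h1 : scaling lin = lin := by
      simp [hlin, scaling_baseField (ha _), scaling_baseField (hb _)]
    have h2 := scaling_baseField hf
    rw [map_sub, h1, sub_eq_zero] at h2
    exact h2
  -- Scaling commutes with the internal derivatives and kills `x` and `y`, so applying it to the
  -- equation for `g` gives the equation for `lin`; subtracting the two gives it for `f`.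
  have hLlin : (coord .x + coord .y) * (intX (intX lin) + intY (intY lin)) +
      intX lin + intY lin = 0 := by
    have h1 := congrArg scaling hL
    simpa [scaling_intX, scaling_intY, hscale] using h1
  refine ⟨g - lin, N, fun k => partialDeriv (.u 1 k) g, fun k => partialDeriv (.u 0 k) g,
    isRationalSolution_of_internal hf ?_, ha, hb, ?_⟩
  · simp only [map_sub]
    linear_combination hL - hLlin
  · rw [vanishesOnProlongation_iff]
    have h1 := ((hasRestriction_baseField hf).add (HasRestriction.sum (s := Finset.range N)
      fun k => (hasRestriction_baseField (ha k)).mul (hasRestriction_w k))).add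
      (HasRestriction.sum (s := Finset.range N)
        fun k => (hasRestriction_baseField (hb k)).mul (hasRestriction_v k))
    have h2 := hg.add h1.neg
    rw [← sub_eq_add_neg, ← sub_eq_add_neg] at h2
    convert! h2 using 1
    rw [add_assoc, ← hlin]
    ring
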